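/- Let $n\ge 2$, and write $|A|$ for the $n$-dimensional Lebesgue measure of $A\subseteq\mathbb{R}^n$. For a convex body $K\subseteq\mathbb{R}^n$ and $\delta\ge 0$, let \[ K_\delta=\bigcap\{H^+ : |K\cap H^-|\le \delta |K|\} \] be the convex floating body, where $H^+,H^-$ run over the pairs of closed half-spaces bounded by a common hyperplane $H$, and let \[ K^\delta=\{x\in\mathbb{R}^n : |\mathrm{conv}(K\cup\{x\})|\le (1+\delta)|K|\} \] be the illumination body. Let $K^\circ=\{y : \langle x,y\rangle\le 1 \text{ for all } x\in K\}$ denote the polar of $K$. For centrally symmetric convex bodies $S_1,S_2$ put \[ \mathtt{d}(S_1,S_2)=\inf\{a\ge 1 : \tfrac1a S_1\subseteq S_2\subseteq aS_1\}, \] and for a centrally symmetric convex body $S$ and $0<\delta<\frac12$ put \[ \mathtt{d}_S(\delta)=\inf_{\delta'>0}\mathtt{d}\bigl(S_\delta,((S^\circ)^{\delta'})^\circ\bigr). \] Then, for the cube $B_\infty^n=\{x\in\mathbb{R}^n : \max_i|x_i|\le 1\}$ and the cross-polytope $B_1^n=\{x\in\mathbb{R}^n : \sum_i|x_i|\le 1\}$,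 \[ \lim_{\delta\to 0^+}\frac{\mathtt{d}_{B_\infty^n}(\delta)-1}{\delta^{1/n}}=\frac{\sqrt[n]{n!}}{n} \qquad\text{and}\qquad \lim_{\delta\to 0^+}\frac{\mathtt{d}_{B_1^n}(\delta)-1}{\delta^{1/n}}=\frac{2^{1/n}}{2}. \] -/

import Mathlib

open Filter Topology
open scoped Pointwise Nat

namespace FloatIllum

/-- The convex floating body `K_δ`: the intersection of all closed half-spaces
`H⁺ = {y | ⟪u, y⟫ ≤ t}` whose opposite closed half-space `H⁻ = {y | t ≤ ⟪u, y⟫}`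
satisfies `|K ∩ H⁻| ≤ δ |K|`. -/
def floatingBody {n : ℕ} (K : Set (EuclideanSpace ℝ (Fin n))) (δ : ℝ) :
    Set (EuclideanSpace ℝ (Fin n)) :=
  {x | ∀ (u : EuclideanSpace ℝ (Fin n)) (t : ℝ), u ≠ 0 →
    MeasureTheory.volume (K ∩ {y | t ≤ inner ℝ u y})
      ≤ ENNReal.ofReal δ * MeasureTheory.volume K →
    inner ℝ u x ≤ t}

/-- The illumination body `K^δ = {x | |conv[K, x]| ≤ (1 + δ) |K|}`. -/
def illuminationBody {n : ℕ} (K : Set (EuclideanSpace ℝ (Fin n))) (δ : ℝ) :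
    Set (EuclideanSpace ℝ (Fin n)) :=
  {x | MeasureTheory.volume (convexHull ℝ (insert x K))
    ≤ ENNReal.ofReal (1 + δ) * MeasureTheory.volume K}

/-- The polar `K° = {y | ⟪x, y⟫ ≤ 1 for all x ∈ K}`. -/
def polarBody {n : ℕ} (K : Set (EuclideanSpace ℝ (Fin n))) :
    Set (EuclideanSpace ℝ (Fin n)) :=
  {y | ∀ x ∈ K, inner ℝ x y ≤ 1}

/-- The body `((S°)^δ)°`, the polar of the illumination body of the polar of `S`. -/
def polarIllumination {n : ℕ} (S : Set (EuclideanSpace ℝ (Fin n))) (δ : ℝ) :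
    Set (EuclideanSpace ℝ (Fin n)) :=
  polarBody (illuminationBody (polarBody S) δ)

/-- The distance `d(S₁, S₂) = inf {a ≥ 1 | (1/a) S₁ ⊆ S₂ ⊆ a S₁}` of two centrally symmetric
convex bodies. -/
noncomputable def bodyDist {n : ℕ} (S₁ S₂ : Set (EuclideanSpace ℝ (Fin n))) : ℝ :=
  sInf {a : ℝ | 1 ≤ a ∧ (1 / a) • S₁ ⊆ S₂ ∧ S₂ ⊆ a • S₁}

/-- `d_S(δ) = inf_{δ' > 0} d(S_δ, ((S°)^δ')°)`. -/
noncomputable def floatIllumDist {n : ℕ} (S : Set (EuclideanSpace ℝ (Fin n))) (δ : ℝ) : ℝ :=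
  ⨅ δ' : Set.Ioi (0 : ℝ), bodyDist (floatingBody S δ) (polarIllumination S (δ' : ℝ))

/-- The cube `B_∞^n`. -/
def cube (n : ℕ) : Set (EuclideanSpace ℝ (Fin n)) :=
  {x | ∀ i, |x i| ≤ 1}

/-- The cross-polytope `B_1^n`. -/
def crossPolytope (n : ℕ) : Set (EuclideanSpace ℝ (Fin n)) :=
  {x | ∑ i, |x i| ≤ 1}

end FloatIllum

/-! Put `η = c δ^{1/n}`, where `c` is such that the floating body `S_δ` is cut off at a vertex `w`
of `S` to relative depth `η`. At points of an edge away from its ends the depth is only `o(η)`: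
symmetric bodies that stay long in the edge direction fit there, with volume of order `η^{n-1}`, far
above `δ`. Let `m` be the number of facets of `S°` and `δ' = ρ / m`. All facet cones of `S°` have
volume `|S°| / m`, so a pyramid of relative height `ρ` over one facet adds `(ρ / m)|S°|`. Hence the
illumination body lies in `(1 + ρ) S°` and reaches that height over the facets except near their
boundaries. Its polar `P` satisfies `S / (1 + ρ) ⊆ P ⊆ S`, and it shrinks by almost the full factor
`1 + ρ` along edges as well. Lower bound: if `a` is admissible in the distance, the vertex gives `a
(1 - η)(1 + ρ) ≥ 1` and an edge point gives `a ≥ (1 - o(η))(1 + ρ)`. The product eliminates `ρ`: `a²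
≥ 1 + η - o(η)`. Upper bound: take `ρ = η / 2`. A cut is either shallow, or its normal points well
into the normal cone of a vertex; there `P` has receded by `1 + η / 2`, which pays for half of the
depth `η`. So the distance is `1 + η / 2 + o(η)` and the limit is `c / 2`
(`tendsto_floatIllumDist`). The volume of a corner gives `c`: `2^n δ = (nη)^n / n!` for the cube,
`2δ = η^n` for the cross-polytope. `mem_floatingBody_of_image` and the facet cone lemmas supply the
geometric input. -/

namespace FloatIllum

open MeasureTheory

variable {n : ℕ}

/-! ### Points of the floating body from symmetric sets around them. -/

theorem volume_inner_eq_zero {u : EuclideanSpace ℝ (Fin n)} (hu : u ≠ 0) :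
    volume {z : EuclideanSpace ℝ (Fin n) | inner ℝ u z = 0} = 0 := by
  have h := Measure.addHaar_submodule (volume : Measure (EuclideanSpace ℝ (Fin n)))
    (LinearMap.ker (innerₛₗ ℝ u)) (by
      intro h
      have : u ∈ LinearMap.ker (innerₛₗ ℝ u) := by rw [h]; trivial
      simp at this
      exact hu this)
  convert h using 2
  ext z
  simp

/-- A hyperplane through the center halves the volume of a centrally symmetric set. -/
theorem two_mul_volume_inter_halfspace {L : Set (EuclideanSpace ℝ (Fin n))}
    (hL : ∀ x ∈ L, -x ∈ L) {u : EuclideanSpace ℝ (Fin n)} (hu : u ≠ 0) :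
    2 * volume (L ∩ {z | 0 ≤ inner ℝ u z}) = volume L := by
  have hm : MeasurableSet {z : EuclideanSpace ℝ (Fin n) | 0 ≤ inner ℝ u z} :=
    measurableSet_le measurable_const (by fun_prop)
  rw [← measure_inter_add_sdiff L hm, two_mul]
  congr 1
  have h1 : L \ {z | 0 ≤ inner ℝ u z} = -(L ∩ {z | 0 < inner ℝ u z}) := by
    ext z
    simp only [Set.mem_sdiff, Set.mem_ofPred_eq, Set.mem_neg, Set.mem_inter_iff, inner_neg_right,
      not_le, Left.neg_pos_iff]
    refine and_congr_left fun _ => ⟨hL z, fun h => ?_⟩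
    simpa using hL _ h
  rw [h1, Measure.measure_neg]
  apply le_antisymm
  · calc volume (L ∩ {z | 0 ≤ inner ℝ u z})
        ≤ volume ((L ∩ {z | 0 < inner ℝ u z}) ∪ {z | inner ℝ u z = 0}) := by
          apply measure_mono
          rintro z ⟨hz, hz'⟩
          rcases (show (0 : ℝ) ≤ inner ℝ u z from hz').lt_or_eq with h | h
          · exact Or.inl ⟨hz, h⟩
          · exact Or.inr h.symm
      _ ≤ _ := (measure_union_le _ _).trans (by rw [volume_inner_eq_zero hu, add_zero])
  · exact measure_mono (Set.inter_subset_inter_right _ fun z hz =>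
      le_of_lt (show (0 : ℝ) < inner ℝ u z from hz))

/-- If a symmetric body `K` contains a translate `p + f K` of a linear image of itself of
volume more than `2δ|K|`, then `p` lies in the floating body `K_δ`. -/
theorem mem_floatingBody_of_image {K : Set (EuclideanSpace ℝ (Fin n))}
    (hK : ∀ x ∈ K, -x ∈ K) (hK0 : volume K ≠ 0) (hK1 : volume K ≠ ⊤) {δ : ℝ} (hδ : 0 ≤ δ)
    {p : EuclideanSpace ℝ (Fin n)}
    (f : EuclideanSpace ℝ (Fin n) →ₗ[ℝ] EuclideanSpace ℝ (Fin n))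
    (hf : ∀ z ∈ K, p + f z ∈ K) (hdet : 2 * δ < |LinearMap.det f|) :
    p ∈ floatingBody K δ := by
  intro u t hu hcut
  by_contra! hlt
  -- A half-space whose boundary passes below `p` contains at least half of any symmetric set
  -- centred at `p`.
  have hsub : p +ᵥ (f '' K ∩ {z | 0 ≤ inner ℝ u z}) ⊆ K ∩ {y | t ≤ inner ℝ u y} := by
    rintro _ ⟨_, ⟨⟨z, hz, rfl⟩, hz'⟩, rfl⟩
    refine ⟨hf z hz, ?_⟩
    have : (0 : ℝ) ≤ inner ℝ u (f z) := hz'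
    simp only [Set.mem_ofPred_eq, vadd_eq_add, inner_add_right]
    linarith
  have h1 := two_mul_volume_inter_halfspace (L := f '' K)
    (by rintro _ ⟨z, hz, rfl⟩; exact ⟨-z, hK z hz, by simp⟩) hu
  rw [Measure.addHaar_image_linearMap] at h1
  have h2 := (measure_mono hsub).trans hcut
  rw [measure_vadd] at h2
  have h3 : ENNReal.ofReal |LinearMap.det f| * volume K ≤ 2 * ENNReal.ofReal δ * volume K := by
    rw [← h1, mul_assoc]; gcongr
  rw [ENNReal.mul_le_mul_iff_left hK0 hK1] at h3
  have h4 : (2 : ENNReal) * ENNReal.ofReal δ = ENNReal.ofReal (2 * δ) := by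
    rw [ENNReal.ofReal_mul (by norm_num)]; simp
  rw [h4, ENNReal.ofReal_le_ofReal_iff'] at h3
  rcases h3 with h3 | h3 <;> linarith

/-! ### Facet cones and the illumination body. -/

/-- The half-open cone over the facet `{y ∈ K | ⟪v, y⟫ = 1}`. -/
def facetCone (K : Set (EuclideanSpace ℝ (Fin n))) (v : EuclideanSpace ℝ (Fin n)) :
    Set (EuclideanSpace ℝ (Fin n)) :=
  {y | ∃ c : ℝ, 0 ≤ c ∧ c < 1 ∧ ∃ f ∈ K, inner ℝ v f = 1 ∧ y = c • f}

/-- The linear part `y ↦ y - ⟪v, y⟫ x` of the affine map fixing `⟪v, ·⟫ = 1` and sending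
`0` to `x`. -/
noncomputable def apexMap (v x : EuclideanSpace ℝ (Fin n)) :
    EuclideanSpace ℝ (Fin n) →ₗ[ℝ] EuclideanSpace ℝ (Fin n) :=
  LinearMap.transvection (innerₛₗ ℝ v) (-x)

theorem apexMap_apply (v x y : EuclideanSpace ℝ (Fin n)) :
    apexMap v x y = y - (inner ℝ v y : ℝ) • x := by
  simp [apexMap, LinearMap.transvection.apply, sub_eq_add_neg]

theorem volume_apex_image (v x : EuclideanSpace ℝ (Fin n)) (h : 1 ≤ (inner ℝ v x : ℝ))
    (C : Set (EuclideanSpace ℝ (Fin n))) :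
    volume (x +ᵥ apexMap v x '' C) = ENNReal.ofReal (inner ℝ v x - 1) * volume C := by
  rw [measure_vadd, Measure.addHaar_image_linearMap, apexMap, LinearMap.transvection.det]
  congr 2
  rw [innerₛₗ_apply_apply, inner_neg_right, abs_of_nonpos (by linarith)]
  ring

/-- The pyramid with apex `x` over the facet lies in the hull, beyond the facet hyperplane.
Requiring `c < 1` in `facetCone` removes the base, so the pyramid is disjoint from `K`. -/
theorem volume_convexHull_insert_ge {K : Set (EuclideanSpace ℝ (Fin n))}
    (hKm : MeasurableSet K) {v x : EuclideanSpace ℝ (Fin n)}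
    (hv : ∀ y ∈ K, inner ℝ v y ≤ (1 : ℝ)) (hx : 1 < (inner ℝ v x : ℝ)) :
    volume K + ENNReal.ofReal (inner ℝ v x - 1) * volume (facetCone K v)
      ≤ volume (convexHull ℝ (insert x K)) := by
  rw [← volume_apex_image v x hx.le, ← measure_union' _ hKm]
  · apply measure_mono
    have hsub := subset_convexHull ℝ (insert x K)
    apply Set.union_subset ((Set.subset_insert x K).trans hsub)
    rintro _ ⟨_, ⟨y, ⟨c, hc0, hc1, f, hf, hvf, rfl⟩, rfl⟩, rfl⟩
    have := convex_convexHull ℝ (insert x K) (hsub (Set.mem_insert x K))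
      (hsub (Set.mem_insert_of_mem x hf)) (sub_nonneg.2 hc1.le) hc0 (by ring)
    convert this using 1
    simp only [vadd_eq_add, apexMap_apply, inner_smul_right, hvf]
    module
  · rw [Set.disjoint_left]
    rintro y hy ⟨_, ⟨_, ⟨c, hc0, hc1, f, hf, hvf, rfl⟩, rfl⟩, rfl⟩
    have := hv _ hy
    simp only [vadd_eq_add, apexMap_apply, inner_smul_right, hvf, inner_add_right,
      inner_sub_right] at this
    nlinarith

/-- By `hvis`, the facet of `v` is the only one visible from `x`, so the part of the hull outside
`K` is covered by a single pyramid. -/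
theorem volume_convexHull_insert_le {K : Set (EuclideanSpace ℝ (Fin n))}
    (hKc : Convex ℝ K) (hKn : K.Nonempty) {v x : EuclideanSpace ℝ (Fin n)}
    (hv : ∀ y ∈ K, inner ℝ v y ≤ (1 : ℝ)) (hx : 1 < (inner ℝ v x : ℝ))
    (hvis : ∀ y ∈ convexHull ℝ (insert x K), inner ℝ v y ≤ (1 : ℝ) → y ∈ K) :
    volume (convexHull ℝ (insert x K))
      ≤ volume K + ENNReal.ofReal (inner ℝ v x - 1) * volume (facetCone K v) := by
  rw [← volume_apex_image v x hx.le]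
  refine (measure_mono ?_).trans (measure_union_le _ _)
  intro y hy
  by_cases hy1 : inner ℝ v y ≤ (1 : ℝ)
  · exact Or.inl (hvis y hy hy1)
  right
  push Not at hy1
  have hy' := hy
  rw [convexHull_insert hKn, hKc.convexHull_eq, mem_convexJoin] at hy'
  obtain ⟨x', hx', k, hk, hyk⟩ := hy'
  rw [Set.mem_singleton_iff] at hx'
  subst hx'
  obtain ⟨l, l', hl0, hl'0, hll, rfl⟩ := hyk
  obtain rfl : l' = 1 - l := by linarith
  set X : ℝ := inner ℝ v x' with hX
  set k1 : ℝ := inner ℝ v k with hk1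
  have hk1' : k1 ≤ 1 := hv k hk
  have hin : (inner ℝ v (l • x' + (1 - l) • k) : ℝ) = l * X + (1 - l) * k1 := by
    simp [inner_add_right, inner_smul_right, hX, hk1]
  rw [hin] at hy1
  -- `m` solves `y = m x' + (1 - m) f` with `⟪v, f⟫ = 1`: it is the weight of the apex when `y` is
  -- joined to the facet.
  set m : ℝ := (l * X + (1 - l) * k1 - 1) / (X - 1) with hm
  have hX1 : 0 < X - 1 := by linarith
  have hmX : m * (X - 1) = l * X + (1 - l) * k1 - 1 := by
    rw [hm]; field_simp
  have hm0 : 0 < m := div_pos (by linarith) hX1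
  have hml : m ≤ l := by
    rw [hm, div_le_iff₀ hX1]; nlinarith
  have hsub := subset_convexHull ℝ (insert x' K)
  have key : ∀ y', inner ℝ v y' = 1 - m → l • x' + (1 - l) • k = y' + m • x' →
      y' ∈ facetCone K v → l • x' + (1 - l) • k ∈ x' +ᵥ apexMap v x' '' facetCone K v := by
    intro y' h1 h2 h3
    refine ⟨_, ⟨y', h3, rfl⟩, ?_⟩
    simp only [vadd_eq_add, apexMap_apply, h1, h2]
    module
  -- Here `y` is the apex. It corresponds to `c = 0` in the cone, and a facet point is still needed;
  -- the segment from `k` to `x'` crosses the facet hyperplane in one.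
  by_cases hm1 : m = 1
  · have hl1 : l = 1 := by linarith
    subst hl1
    apply key 0 (by simp [hm1]) (by simp [hm1])
    obtain ⟨f, hf⟩ : ∃ f, f ∈ K ∧ inner ℝ v f = (1 : ℝ) := by
      have hd : 0 < X - k1 := by linarith
      let b := (1 - k1) / (X - k1)
      have hb0 : 0 ≤ b := div_nonneg (by linarith) hd.le
      have hb1 : b ≤ 1 := by rw [div_le_one hd]; linarith
      have hb : b * (X - k1) = 1 - k1 := by simp only [b]; field_simp
      have e : (inner ℝ v (b • x' + (1 - b) • k) : ℝ) = 1 := by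
        simp only [inner_add_right, inner_smul_right, ← hX, ← hk1]
        linarith
      exact ⟨_, hvis _ (convex_convexHull ℝ (insert x' K) (hsub (Set.mem_insert x' K))
        (hsub (Set.mem_insert_of_mem x' hk)) hb0 (sub_nonneg.2 hb1) (by ring)) e.le, e⟩
    exact ⟨0, le_rfl, one_pos, f, hf.1, hf.2, by simp⟩
  · have hm1 : m < 1 := lt_of_le_of_ne (by linarith) hm1
    have hm2 : 0 < 1 - m := by linarith
    let f := ((l - m) / (1 - m)) • x' + ((1 - l) / (1 - m)) • k
    have hvf : (inner ℝ v f : ℝ) = 1 := by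
      simp only [f, inner_add_right, inner_smul_right, ← hX, ← hk1]
      field_simp
      linarith
    have hf : f ∈ K := by
      apply hvis _ _ hvf.le
      apply convex_convexHull ℝ (insert x' K) (hsub (Set.mem_insert x' K))
        (hsub (Set.mem_insert_of_mem x' hk)) (div_nonneg (by linarith) hm2.le)
        (div_nonneg (by linarith) hm2.le)
      field_simp
      ring
    apply key ((1 - m) • f)
    · rw [inner_smul_right, hvf, mul_one]
    · simp only [f, smul_add, smul_smul]
      rw [mul_div_cancel₀ _ hm2.ne', mul_div_cancel₀ _ hm2.ne']
      module
    · exact ⟨1 - m, hm2.le, by linarith, f, hf, hvf, rfl⟩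

/-- A point of the illumination body is cut off from the facet `⟪v, ·⟫ = 1` by at most the height
determined by the volume of the cone over that facet. -/
theorem inner_le_of_mem_illuminationBody {K : Set (EuclideanSpace ℝ (Fin n))}
    (hKm : MeasurableSet K) (hK0 : volume K ≠ 0) (hK1 : volume K ≠ ⊤)
    {v x : EuclideanSpace ℝ (Fin n)} (hv : ∀ y ∈ K, inner ℝ v y ≤ (1 : ℝ)) {m ρ : ℝ} (hm : 0 < m)
    (hρ : 0 ≤ ρ) (hC : ENNReal.ofReal m * volume (facetCone K v) = volume K)
    (hx : x ∈ illuminationBody K (ρ / m)) : (inner ℝ v x : ℝ) ≤ 1 + ρ := by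
  by_contra! hlt
  have h := (volume_convexHull_insert_ge hKm hv (x := x) (by linarith)).trans hx
  rw [ENNReal.ofReal_add zero_le_one (by positivity), add_mul, ENNReal.ofReal_one, one_mul,
    ENNReal.add_le_add_iff_left hK1, ← hC, ← mul_assoc, ← ENNReal.ofReal_mul (by positivity),
    div_mul_cancel₀ _ hm.ne', ENNReal.mul_le_mul_iff_left, ENNReal.ofReal_le_ofReal_iff hρ] at h
  · linarith
  · intro h0; rw [h0, mul_zero] at hC; exact hK0 hC.symm
  · intro h0; rw [h0, ENNReal.mul_top (by simpa using hm)] at hC; exact hK1 hC.symm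

/-- By `hC` the facet cone has volume `|K| / m`, so a pyramid of height at most `ρ` adds at most `(ρ
/ m)|K|`. This is the origin of the parameter `ρ / m`. -/
theorem mem_illuminationBody_of_inner_le {K : Set (EuclideanSpace ℝ (Fin n))}
    (hKc : Convex ℝ K) (hKn : K.Nonempty)
    {v x : EuclideanSpace ℝ (Fin n)} (hv : ∀ y ∈ K, inner ℝ v y ≤ (1 : ℝ)) {m ρ : ℝ} (hm : 0 < m)
    (hρ : 0 ≤ ρ) (hC : ENNReal.ofReal m * volume (facetCone K v) = volume K)
    (hx1 : 1 < (inner ℝ v x : ℝ)) (hx : (inner ℝ v x : ℝ) ≤ 1 + ρ)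
    (hvis : ∀ y ∈ convexHull ℝ (insert x K), inner ℝ v y ≤ (1 : ℝ) → y ∈ K) :
    x ∈ illuminationBody K (ρ / m) := by
  refine (volume_convexHull_insert_le hKc hKn hv hx1 hvis).trans ?_
  rw [ENNReal.ofReal_add zero_le_one (by positivity), add_mul, ENNReal.ofReal_one, one_mul]
  refine add_le_add le_rfl ?_
  rw [← hC, ← mul_assoc, ← ENNReal.ofReal_mul (by positivity), div_mul_cancel₀ _ hm.ne']
  gcongr
  linarith

theorem subset_illuminationBody {K : Set (EuclideanSpace ℝ (Fin n))} (hKc : Convex ℝ K) {δ : ℝ}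
    (hδ : 0 ≤ δ) : K ⊆ illuminationBody K δ := by
  intro x hx
  change volume _ ≤ _
  rw [Set.insert_eq_of_mem hx, hKc.convexHull_eq]
  refine le_mul_of_one_le_left' ?_
  rw [ENNReal.one_le_ofReal]
  linarith

theorem illuminationBody_mono (K : Set (EuclideanSpace ℝ (Fin n))) {δ δ' : ℝ} (h : δ ≤ δ') :
    illuminationBody K δ ⊆ illuminationBody K δ' := by
  intro x hx
  refine le_trans (show volume _ ≤ _ from hx) ?_
  gcongr

theorem polarIllumination_anti (S : Set (EuclideanSpace ℝ (Fin n))) {δ δ' : ℝ} (h : δ ≤ δ') :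
    polarIllumination S δ' ⊆ polarIllumination S δ :=
  fun _ hy x hx => hy x (illuminationBody_mono _ h hx)

/-- Finitely many almost disjoint sets of the same volume exhaust the volume of their union. -/
theorem card_mul_volume_eq {ι : Type*} [Fintype ι] {C : ι → Set (EuclideanSpace ℝ (Fin n))}
    {V : Set (EuclideanSpace ℝ (Fin n))} (hm : ∀ i, NullMeasurableSet (C i) volume)
    (hd : Pairwise fun i j => volume (C i ∩ C j) = 0) (hV : volume V = volume (⋃ i, C i))
    (i₀ : ι) (he : ∀ i, volume (C i) = volume (C i₀)) :
    ENNReal.ofReal (Fintype.card ι) * volume (C i₀) = volume V := by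
  rw [hV, measure_iUnion₀ hd hm, tsum_fintype, Finset.sum_congr rfl fun i _ => he i]
  simp

theorem mem_smul_floatingBody {S : Set (EuclideanSpace ℝ (Fin n))} {δ a : ℝ} (ha : 0 < a)
    {y : EuclideanSpace ℝ (Fin n)}
    (h : ∀ (u : EuclideanSpace ℝ (Fin n)) (t : ℝ), u ≠ 0 →
      volume (S ∩ {y | t ≤ inner ℝ u y}) ≤ ENNReal.ofReal δ * volume S →
      (inner ℝ u y : ℝ) ≤ a * t) : y ∈ a • floatingBody S δ := by
  refine ⟨(1 / a) • y, fun u t hu hcut => ?_, ?_⟩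
  · rw [inner_smul_right, one_div, inv_mul_le_iff₀ ha]
    exact h u t hu hcut
  · simp [smul_smul, ha.ne']

/-! ### The asymptotic argument common to both bodies. -/

/-- Sufficient conditions on `S` for `d_S(δ) = 1 + η / 2 + o(η)` with `η = c δ^{1/n}`. -/
theorem tendsto_floatIllumDist (hn : n ≠ 0) {S : Set (EuclideanSpace ℝ (Fin n))} {m c : ℝ}
    (hm : 0 < m) (hc : 0 < c) (hbal : ∀ x ∈ S, ∀ r : ℝ, 0 ≤ r → r ≤ 1 → r • x ∈ S)
    (hfl : ∀ δ : ℝ, floatingBody S δ ⊆ S)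
    (hPS : ∀ ρ : ℝ, 0 < ρ → polarIllumination S (ρ / m) ⊆ S)
    (hSP : ∀ ρ : ℝ, 0 < ρ → ∀ y ∈ S, (1 / (1 + ρ)) • y ∈ polarIllumination S (ρ / m))
    {u₀ w : EuclideanSpace ℝ (Fin n)} (hw : w ∈ S) (hu₀ : (inner ℝ u₀ w : ℝ) = 1)
    (hcut : ∀ η : ℝ, 0 < η → η ≤ 1 → ∀ y ∈ floatingBody S ((η / c) ^ n),
      (inner ℝ u₀ y : ℝ) ≤ 1 - η)
    (hpt : ∀ s : ℝ, 0 < s → s < 1 / 4 → ∀ᶠ η : ℝ in 𝓝[>] 0,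
      ∃ y ∈ floatingBody S ((η / c) ^ n), ∀ ρ : ℝ, 0 < ρ → ρ ≤ η → ∀ a : ℝ, 0 < a →
        (1 / a) • y ∈ polarIllumination S (ρ / m) → (1 - 3 * s * η) * (1 + ρ) ≤ a)
    (hup : ∀ s : ℝ, 0 < s → s < 1 / 4 → ∀ᶠ η : ℝ in 𝓝[>] 0,
      ∀ (u : EuclideanSpace ℝ (Fin n)) (t : ℝ), u ≠ 0 →
        volume (S ∩ {y | t ≤ inner ℝ u y}) ≤ ENNReal.ofReal ((η / c) ^ n) * volume S →
        ∃ U : ℝ, 0 ≤ U ∧ (∀ y ∈ S, (inner ℝ u y : ℝ) ≤ U) ∧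
          ((1 - 3 * s * η) * U ≤ t ∨ ((1 - (1 + s) * η) * U ≤ t ∧
            ∀ y ∈ polarIllumination S (η / 2 / m), (inner ℝ u y : ℝ) ≤ U / (1 + η / 2)))) :
    Tendsto (fun δ : ℝ => (floatIllumDist S δ - 1) / δ ^ ((1 : ℝ) / (n : ℝ))) (𝓝[>] (0 : ℝ))
      (𝓝 (c / 2)) := by
  have hdist : ∀ S₁ S₂ : Set (EuclideanSpace ℝ (Fin n)), 0 ≤ bodyDist S₁ S₂ := fun S₁ S₂ =>
    Real.sInf_nonneg fun a ha => zero_le_one.trans ha.1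
  have key : Tendsto (fun η : ℝ => (floatIllumDist S ((η / c) ^ n) - 1) / η) (𝓝[>] (0 : ℝ))
      (𝓝 (1 / 2)) := by
    have main : ∀ ε : ℝ, 0 < ε → ε < 1 → ∀ᶠ η : ℝ in 𝓝[>] 0,
        1 + (1 / 2 - ε) * η ≤ floatIllumDist S ((η / c) ^ n) ∧
          floatIllumDist S ((η / c) ^ n) ≤ 1 + (1 / 2 + ε) * η := by
      intro ε hε hε1
      -- With `s = ε / 6` the loss `3 s η` is `ε η / 2`, within the allowed error.
      have hs : 0 < ε / 6 := by positivity
      have hs4 : ε / 6 < 1 / 4 := by linarith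
      filter_upwards [hpt _ hs hs4, hup _ hs hs4, self_mem_nhdsWithin,
        nhdsWithin_le_nhds (gt_mem_nhds (show (0 : ℝ) < 1 / 4 by norm_num)),
        nhdsWithin_le_nhds (gt_mem_nhds (show (0 : ℝ) < ε / 16 by positivity))]
        with η ⟨p, hp, hpa⟩ hupη hη hη4 hηε
      replace hη : 0 < η := hη
      set F := floatingBody S ((η / c) ^ n) with hF
      have hupper : F ⊆ S := hfl _
      constructor
      · have : Nonempty (Set.Ioi (0 : ℝ)) := ⟨⟨1, Set.mem_Ioi.2 one_pos⟩⟩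
        refine le_ciInf fun δ' => ?_
        obtain ⟨δ', hδ'⟩ := δ'
        replace hδ' : 0 < δ' := hδ'
        obtain ⟨ρ, hρ, rfl⟩ : ∃ ρ : ℝ, 0 < ρ ∧ δ' = ρ / m :=
          ⟨δ' * m, by positivity, by field_simp⟩
        -- Nonemptiness matters, since `sInf ∅ = 0`. The value `2 + ρ` is admissible: the floating
        -- body lies in `S ⊆ (1 + ρ) P`, and `P ⊆ S` while every cut has `t ≥ U / 2`.
        refine le_csInf ⟨2 + ρ, by linarith, ?_, ?_⟩ ?_
        · rintro _ ⟨y, hy, rfl⟩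
          have := hSP ρ hρ _ (hbal y (hupper hy) ((1 + ρ) / (2 + ρ)) (by positivity)
            ((div_le_one (by positivity)).2 (by linarith)))
          convert this using 1
          rw [smul_smul]
          field_simp
        · intro y hy
          refine mem_smul_floatingBody (by positivity) fun u t hu ht => ?_
          obtain ⟨U, hU, hSU, hor⟩ := hupη u t hu ht
          have h1 := hSU y (hPS ρ hρ hy)
          have h2 : U / 2 ≤ t := by
            rcases hor with h | h
            · nlinarith [mul_nonneg hη.le hU]
            · nlinarith [mul_nonneg hη.le hU, h.1]
          nlinarith
        · rintro a ⟨ha1, haF, haP⟩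
          -- Vertex estimate: `w / (1 + ρ)` lies in the polar body, hence in `a • F`, and `F` stays
          -- below `1 - η` in direction `u₀`.
          have hA : 1 ≤ a * (1 - η) * (1 + ρ) := by
            obtain ⟨z, hz, hz'⟩ := haP (hSP ρ hρ w hw)
            have h1 := hcut η hη (by linarith) z hz
            have h2 : a * inner ℝ u₀ z = 1 / (1 + ρ) := by
              simpa [inner_smul_right, hu₀] using congrArg (fun x => (inner ℝ u₀ x : ℝ)) hz'
            have h3 : 1 / (1 + ρ) ≤ a * (1 - η) := by
              rw [← h2]; exact mul_le_mul_of_nonneg_left h1 (by linarith)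
            rwa [div_le_iff₀ (by positivity)] at h3
          -- Edge estimate. It is available only for parameters up to `η`; for larger `ρ` the polar
          -- body is smaller still, so `ρ' = η` may be used.
          have hB : ∀ ρ' : ℝ, 0 < ρ' → ρ' ≤ ρ → ρ' ≤ η → (1 - 3 * (ε / 6) * η) * (1 + ρ') ≤ a :=
            fun ρ' h0 h1 h2 => hpa ρ' h0 h2 a (by linarith)
              (polarIllumination_anti S (div_le_div_of_nonneg_right h1 hm.le) (haF ⟨p, hp, rfl⟩))
          have hε' : 0 < 1 - 3 * (ε / 6) * η := by nlinarith
          -- If `ρ ≤ η`, multiplying the two estimates cancels `1 + ρ`. If `ρ ≥ η`, the edge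
          -- estimate at `η` and `a ≥ 1` suffice.
          have hsq : (1 - 3 * (ε / 6) * η) * (1 + η) ≤ a ^ 2 := by
            rcases le_total ρ η with h | h
            · have h1 := hB ρ hρ le_rfl h
              have h2 : (1 - 3 * (ε / 6) * η) ≤ a ^ 2 * (1 - η) := by
                have h4 : 0 ≤ a * (1 - η) := by nlinarith
                have h3 := mul_le_mul_of_nonneg_left h1 h4
                nlinarith [mul_le_mul_of_nonneg_left hA hε'.le]
              have h5 := mul_le_mul_of_nonneg_right h2 (show 0 ≤ 1 + η by linarith)
              nlinarith [sq_nonneg (a * η)]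
            · have := hB η hη h le_rfl
              nlinarith
          by_contra! hlt
          have h6 : a ^ 2 < (1 + (1 / 2 - ε) * η) ^ 2 := by
            gcongr
          nlinarith [mul_pos hη hε, mul_pos hη hη]
      -- The choice `ρ = η / 2` balances the two inclusions.
      · have hρ : 0 < η / 2 / m := by positivity
        refine (ciInf_le ⟨0, ?_⟩ (⟨η / 2 / m, hρ⟩ : Set.Ioi (0 : ℝ))).trans
          (csInf_le ⟨1, fun a ha => ha.1⟩ ⟨by nlinarith, ?_, ?_⟩)
        · rintro _ ⟨δ', rfl⟩; exact hdist _ _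
        · rintro _ ⟨y, hy, rfl⟩
          have ha : 0 < 1 + (1 / 2 + ε) * η := by positivity
          have := hSP (η / 2) (by positivity) _ (hbal y (hupper hy)
            ((1 + η / 2) / (1 + (1 / 2 + ε) * η)) (by positivity)
            ((div_le_one (by positivity)).2 (by nlinarith)))
          convert this using 1
          rw [smul_smul]
          field_simp
        · intro y hy
          refine mem_smul_floatingBody (by positivity) fun u t hu ht => ?_
          have ha : 0 ≤ 1 + (1 / 2 + ε) * η := by positivity
          obtain ⟨U, hU, hSU, h | ⟨h, h'⟩⟩ := hupη u t hu ht
          · refine (hSU y (hPS _ (by positivity) hy)).trans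
              (le_trans ?_ (mul_le_mul_of_nonneg_left h ha))
            rw [← mul_assoc]
            refine le_mul_of_one_le_left hU ?_
            have h1 : ε / 2 * (1 / 2 + ε) ≤ 3 / 4 := by nlinarith
            have h2 : 0 ≤ 1 / 2 + ε / 2 - ε / 2 * (1 / 2 + ε) * η := by nlinarith
            nlinarith [mul_nonneg hη.le h2]
          · refine (h' y hy).trans (le_trans ?_ (mul_le_mul_of_nonneg_left h ha))
            rw [div_le_iff₀ (by positivity), ← mul_assoc, mul_right_comm]
            refine le_mul_of_one_le_left hU ?_
            have e : (1 + (1 / 2 + ε) * η) * (1 - (1 + ε / 6) * η) * (1 + η / 2)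
                = 1 + η * (5 * ε / 6 - η * (3 / 4 + ε / 6 * (1 + ε) + ε / 2
                  + η * (1 / 2 + ε) * (1 + ε / 6) / 2)) := by ring
            rw [e]
            have h1 : 3 / 4 + ε / 6 * (1 + ε) + ε / 2
                  + η * (1 / 2 + ε) * (1 + ε / 6) / 2 ≤ 4 := by
              nlinarith [mul_pos hη hε, mul_pos hη (mul_pos hε hε)]
            have h2 : 0 ≤ 5 * ε / 6 - η * (3 / 4 + ε / 6 * (1 + ε) + ε / 2
                  + η * (1 / 2 + ε) * (1 + ε / 6) / 2) := by
              nlinarith [mul_le_mul_of_nonneg_left h1 hη.le]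
            nlinarith [mul_nonneg hη.le h2]
    rw [Metric.tendsto_nhds]
    intro ε hε
    have hε' : 0 < min (ε / 2) (1 / 2) := by positivity
    filter_upwards [main _ hε' (by linarith [min_le_right (ε / 2) (1 / 2)]),
      self_mem_nhdsWithin] with η ⟨h1, h2⟩ hη
    replace hη : 0 < η := hη
    have h3 : min (ε / 2) (1 / 2) ≤ ε / 2 := min_le_left _ _
    rw [Real.dist_eq, abs_lt]
    constructor
    · rw [lt_sub_iff_add_lt, lt_div_iff₀ hη]
      nlinarith
    · rw [sub_lt_iff_lt_add, div_lt_iff₀ hη]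
      nlinarith
  have hn0 : (0 : ℝ) < n := by positivity
  have hlim : Tendsto (fun δ : ℝ => c * δ ^ ((1 : ℝ) / (n : ℝ))) (𝓝[>] 0) (𝓝[>] 0) := by
    refine tendsto_nhdsWithin_iff.2 ⟨?_, ?_⟩
    · have h1 : ContinuousAt (fun δ : ℝ => c * δ ^ ((1 : ℝ) / (n : ℝ))) 0 :=
        continuousAt_const.mul (Real.continuousAt_rpow_const _ _ (Or.inr (by positivity)))
      have h2 := h1.tendsto
      rw [Real.zero_rpow (by positivity), mul_zero] at h2
      exact h2.mono_left nhdsWithin_le_nhds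
    · filter_upwards [self_mem_nhdsWithin] with δ hδ
      exact mul_pos hc (Real.rpow_pos_of_pos hδ _)
  have h := (key.comp hlim).const_mul c
  rw [mul_one_div] at h
  refine h.congr' ?_
  filter_upwards [self_mem_nhdsWithin] with δ hδ
  replace hδ : 0 < δ := hδ
  have h1 : (c * δ ^ ((1 : ℝ) / (n : ℝ)) / c) ^ n = δ := by
    rw [mul_div_cancel_left₀ _ hc.ne', ← Real.rpow_natCast, ← Real.rpow_mul hδ.le,
      one_div_mul_cancel hn0.ne', Real.rpow_one]
  have h2 : 0 < δ ^ ((1 : ℝ) / (n : ℝ)) := Real.rpow_pos_of_pos hδ _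
  simp only [Function.comp_apply, h1]
  field_simp

/-! ### Decomposition of a polytope into congruent facet cones. -/

theorem inner_eq_sum (u y : EuclideanSpace ℝ (Fin n)) : (inner ℝ u y : ℝ) = ∑ i, u i * y i := by
  simp [PiLp.inner_apply, mul_comm]

theorem volume_inner_eq_const {u : EuclideanSpace ℝ (Fin n)} (hu : u ≠ 0) (t : ℝ) :
    volume {z : EuclideanSpace ℝ (Fin n) | inner ℝ u z = t} = 0 := by
  have h : {z : EuclideanSpace ℝ (Fin n) | inner ℝ u z = t} ⊆
      ((t / ‖u‖ ^ 2) • u) +ᵥ {z : EuclideanSpace ℝ (Fin n) | inner ℝ u z = 0} := by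
    intro z hz
    refine ⟨z - (t / ‖u‖ ^ 2) • u, ?_, by simp⟩
    have hz' : inner ℝ u z = t := hz
    have hu' : ‖u‖ ≠ 0 := norm_ne_zero_iff.2 hu
    simp only [Set.mem_ofPred_eq, inner_sub_right, inner_smul_right, real_inner_self_eq_norm_sq,
      hz']
    field_simp
    ring
  refine measure_mono_null h ?_
  rw [measure_vadd, volume_inner_eq_zero hu]

/-- The half-open cone is exhausted by the compact cones `0 ≤ c ≤ 1 - 1 / (k + 1)`. -/
theorem measurableSet_facetCone {K : Set (EuclideanSpace ℝ (Fin n))} (hK : IsCompact K)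
    (v : EuclideanSpace ℝ (Fin n)) : MeasurableSet (facetCone K v) := by
  have hF : IsCompact (K ∩ {f | inner ℝ v f = (1 : ℝ)}) :=
    hK.inter_right (isClosed_eq (by fun_prop) continuous_const)
  have h : facetCone K v = ⋃ k : ℕ, (fun p : ℝ × EuclideanSpace ℝ (Fin n) => p.1 • p.2) ''
      (Set.Icc 0 (1 - 1 / ((k : ℝ) + 1)) ×ˢ (K ∩ {f | inner ℝ v f = (1 : ℝ)})) := by
    ext y
    simp only [facetCone, Set.mem_ofPred_eq, Set.mem_iUnion, Set.mem_image, Prod.exists,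
      Set.mem_prod, Set.mem_Icc, Set.mem_inter_iff]
    constructor
    · rintro ⟨c, h0, h1, f, hf, hvf, rfl⟩
      obtain ⟨k, hk⟩ := exists_nat_one_div_lt (sub_pos.2 h1)
      exact ⟨k, c, f, ⟨⟨h0, by linarith⟩, hf, hvf⟩, rfl⟩
    · rintro ⟨k, c, f, ⟨⟨h0, h1⟩, hf, hvf⟩, rfl⟩
      have : 0 < 1 / ((k : ℝ) + 1) := by positivity
      exact ⟨c, h0, by linarith, f, hf, hvf, rfl⟩
  rw [h]
  exact MeasurableSet.iUnion fun k =>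
    ((isCompact_Icc.prod hF).image continuous_smul).isClosed.measurableSet

theorem volume_facetCone_map {K : Set (EuclideanSpace ℝ (Fin n))}
    (g : EuclideanSpace ℝ (Fin n) ≃ₗᵢ[ℝ] EuclideanSpace ℝ (Fin n))
    (hg : ∀ x, g x ∈ K ↔ x ∈ K) (v : EuclideanSpace ℝ (Fin n)) :
    volume (facetCone K (g v)) = volume (facetCone K v) := by
  have h : facetCone K v = g.toMeasurableEquiv ⁻¹' facetCone K (g v) := by
    ext y
    simp only [facetCone, Set.mem_ofPred_eq, Set.mem_preimage,
      LinearIsometryEquiv.coe_toMeasurableEquiv]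
    constructor
    · rintro ⟨c, h0, h1, f, hf, hvf, rfl⟩
      exact ⟨c, h0, h1, g f, (hg f).2 hf, by rw [g.inner_map_map, hvf], by simp⟩
    · rintro ⟨c, h0, h1, f, hf, hvf, hy⟩
      refine ⟨c, h0, h1, g.symm f, (hg _).1 (by simpa using hf), ?_, ?_⟩
      · rw [← g.inner_map_map, g.apply_symm_apply, hvf]
      · rw [← map_smul, ← hy, g.symm_apply_apply]
  rw [h, MeasurePreserving.measure_preimage_equiv g.measurePreserving]

/-- A polytope whose facets all span congruent cones is divided evenly by these cones. -/
theorem card_mul_volume_facetCone {ι : Type*} [Fintype ι] {v : ι → EuclideanSpace ℝ (Fin n)}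
    (hv : Function.Injective v) (hv0 : ∀ i, v i ≠ 0) {K : Set (EuclideanSpace ℝ (Fin n))}
    (hK : ∀ y, y ∈ K ↔ ∀ i, (inner ℝ (v i) y : ℝ) ≤ 1) (hKc : IsCompact K)
    (hF : ∀ i, ∃ f ∈ K, (inner ℝ (v i) f : ℝ) = 1) (i₀ : ι)
    (he : ∀ i, volume (facetCone K (v i)) = volume (facetCone K (v i₀))) :
    ENNReal.ofReal (Fintype.card ι) * volume (facetCone K (v i₀)) = volume K := by
  -- On the cone over facet `i` the functional `v i` is the largest, so two cones meet inside the
  -- hyperplane `⟪v i - v j, ·⟫ = 0`.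
  have hle : ∀ i j, ∀ y ∈ facetCone K (v i), (inner ℝ (v j) y : ℝ) ≤ inner ℝ (v i) y := by
    rintro i j _ ⟨c, h0, h1, f, hf, hvf, rfl⟩
    rw [inner_smul_right, inner_smul_right, hvf]
    exact mul_le_mul_of_nonneg_left ((hK f).1 hf j) h0
  refine card_mul_volume_eq (fun i => (measurableSet_facetCone hKc _).nullMeasurableSet) ?_ ?_ i₀ he
  · intro i j hij
    refine measure_mono_null ?_ (volume_inner_eq_zero (sub_ne_zero.2 (hv.ne hij)))
    rintro y ⟨hi, hj⟩
    have h1 := hle i j y hi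
    have h2 := hle j i y hj
    simp only [Set.mem_ofPred_eq, inner_sub_left]
    linarith
  · apply le_antisymm
    · have hsub : K ⊆ (⋃ i, facetCone K (v i)) ∪ ⋃ i, {y | inner ℝ (v i) y = (1 : ℝ)} := by
        intro y hy
        by_cases hy1 : ∃ i, inner ℝ (v i) y = (1 : ℝ)
        · exact Or.inr (Set.mem_iUnion.2 hy1)
        left
        push Not at hy1
        obtain ⟨i, -, hi⟩ := Finset.exists_max_image Finset.univ
          (fun i => (inner ℝ (v i) y : ℝ)) ⟨i₀, Finset.mem_univ _⟩
        have hi1 : (inner ℝ (v i) y : ℝ) < 1 := lt_of_le_of_ne ((hK y).1 hy i) (hy1 i)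
        refine Set.mem_iUnion.2 ⟨i, ?_⟩
        rcases lt_or_ge 0 (inner ℝ (v i) y : ℝ) with hp | hp
        · refine ⟨_, hp.le, hi1, (inner ℝ (v i) y : ℝ)⁻¹ • y, (hK _).2 fun j => ?_, ?_, ?_⟩
          · rw [inner_smul_right, inv_mul_le_iff₀ hp, mul_one]
            exact hi j (Finset.mem_univ _)
          · rw [inner_smul_right, inv_mul_cancel₀ hp.ne']
          · rw [smul_inv_smul₀ hp.ne']
        -- If no functional is positive at `y`, the whole ray through `y` lies in `K`, and
        -- boundedness forces `y = 0`.
        · have hy0 : y = 0 := by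
            by_contra hne
            obtain ⟨R, hR⟩ := hKc.isBounded.exists_norm_le
            have hR0 : 0 ≤ R := (norm_nonneg y).trans (hR y hy)
            have hpos : 0 < ‖y‖ := norm_pos_iff.2 hne
            have hm : ((R + 1) / ‖y‖) • y ∈ K := by
              refine (hK _).2 fun j => ?_
              rw [inner_smul_right]
              have h1 : (inner ℝ (v j) y : ℝ) ≤ 0 := (hi j (Finset.mem_univ _)).trans hp
              have h2 : 0 ≤ (R + 1) / ‖y‖ := by positivity
              nlinarith
            have := hR _ hm
            rw [norm_smul, Real.norm_of_nonneg (by positivity), div_mul_cancel₀ _ hpos.ne'] at this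
            linarith
          obtain ⟨f, hf, hvf⟩ := hF i
          exact ⟨0, le_rfl, one_pos, f, hf, hvf, by simp [hy0]⟩
      refine (measure_mono hsub).trans ((measure_union_le _ _).trans ?_)
      rw [measure_iUnion_null fun i => volume_inner_eq_const (hv0 i) 1, add_zero]
    · apply measure_mono
      apply Set.iUnion_subset
      rintro i y hy
      refine (hK y).2 fun j => (hle i j y hy).trans ?_
      obtain ⟨c, h0, h1, f, hf, hvf, rfl⟩ := hy
      rw [inner_smul_right, hvf]
      linarith

/-! ### Cube and cross-polytope: facets, volumes, polarity. -/

/-- The diagonal linear map with entries `w`. -/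
noncomputable def diagMap (w : Fin n → ℝ) :
    EuclideanSpace ℝ (Fin n) →ₗ[ℝ] EuclideanSpace ℝ (Fin n) :=
  Matrix.toLpLin 2 2 (Matrix.diagonal w)

theorem diagMap_apply (w : Fin n → ℝ) (z : EuclideanSpace ℝ (Fin n)) (i : Fin n) :
    diagMap w z i = w i * z i := by
  simp [diagMap, Matrix.toLpLin_apply, Matrix.mulVec_diagonal]

theorem det_diagMap (w : Fin n → ℝ) : LinearMap.det (diagMap w) = ∏ i, w i := by
  rw [diagMap, Matrix.toLpLin_eq_toLin, LinearMap.det_toLin, Matrix.det_diagonal]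

/-- The vector with entries `±1` prescribed by `σ`. -/
noncomputable def signVec (σ : Fin n → Bool) : EuclideanSpace ℝ (Fin n) :=
  WithLp.toLp 2 fun i => if σ i then 1 else -1

theorem signVec_apply (σ : Fin n → Bool) (i : Fin n) :
    signVec σ i = if σ i then 1 else -1 := rfl

theorem abs_signVec (σ : Fin n → Bool) (i : Fin n) : |signVec σ i| = 1 := by
  rw [signVec_apply]; split_ifs <;> simp

theorem signVec_injective : Function.Injective (signVec (n := n)) := by
  intro σ τ h
  funext i
  have := congrArg (fun x : EuclideanSpace ℝ (Fin n) => x i) h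
  simp only [signVec_apply] at this
  cases hσ : σ i <;> cases hτ : τ i <;> simp [hσ, hτ] at this ⊢ <;> norm_num at this

/-- The vector `± e_i`. -/
noncomputable def axisVec (p : Fin n × Bool) : EuclideanSpace ℝ (Fin n) :=
  EuclideanSpace.single p.1 (if p.2 then 1 else -1)

theorem inner_axisVec (p : Fin n × Bool) (y : EuclideanSpace ℝ (Fin n)) :
    (inner ℝ (axisVec p) y : ℝ) = if p.2 then y p.1 else -y p.1 := by
  rw [axisVec, EuclideanSpace.inner_single_left]
  split_ifs <;> simp

theorem axisVec_injective : Function.Injective (axisVec (n := n)) := by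
  rintro ⟨i, a⟩ ⟨j, b⟩ h
  have h1 := congrArg (fun x => (inner ℝ x (EuclideanSpace.single i (1 : ℝ)) : ℝ)) h
  simp only [inner_axisVec] at h1
  by_cases hij : i = j
  · subst hij
    cases a <;> cases b <;> simp at h1 ⊢ <;> norm_num at h1
  · cases a <;> cases b <;> simp [Ne.symm hij] at h1

theorem mem_cube_iff_axisVec (y : EuclideanSpace ℝ (Fin n)) :
    y ∈ cube n ↔ ∀ p, (inner ℝ (axisVec p) y : ℝ) ≤ 1 := by
  simp only [cube, Set.mem_ofPred_eq, inner_axisVec, abs_le]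
  refine ⟨fun h p => ?_, fun h i => ⟨?_, ?_⟩⟩
  · have := h p.1
    split_ifs <;> linarith
  · have := h (i, false)
    simp only [Bool.false_eq_true, if_false] at this
    linarith
  · simpa using h (i, true)

theorem inner_signVec_le (σ : Fin n → Bool) (y : EuclideanSpace ℝ (Fin n)) :
    (inner ℝ (signVec σ) y : ℝ) ≤ ∑ i, |y i| := by
  rw [inner_eq_sum]
  refine Finset.sum_le_sum fun i _ => (le_abs_self _).trans ?_
  rw [abs_mul, abs_signVec, one_mul]

theorem exists_inner_signVec_eq (y : EuclideanSpace ℝ (Fin n)) :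
    ∃ σ, (inner ℝ (signVec σ) y : ℝ) = ∑ i, |y i| ∧ ∀ i, signVec σ i * y i = |y i| := by
  have h : ∀ i, signVec (fun i => decide (0 ≤ y i)) i * y i = |y i| := by
    intro i
    rw [signVec_apply]
    by_cases hi : 0 ≤ y i
    · simp [hi, abs_of_nonneg hi]
    · simp [hi, abs_of_neg (not_le.1 hi)]
  exact ⟨_, by rw [inner_eq_sum]; exact Finset.sum_congr rfl fun i _ => h i, h⟩

theorem mem_crossPolytope_iff_signVec (y : EuclideanSpace ℝ (Fin n)) :
    y ∈ crossPolytope n ↔ ∀ σ, (inner ℝ (signVec σ) y : ℝ) ≤ 1 := by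
  constructor
  · exact fun h σ => (inner_signVec_le σ y).trans h
  · intro h
    obtain ⟨σ, hσ, -⟩ := exists_inner_signVec_eq y
    change ∑ i, |y i| ≤ 1
    rw [← hσ]
    exact h σ

theorem isCompact_cube (n : ℕ) : IsCompact (cube n) := by
  have h : cube n = (WithLp.toLp 2) '' (Set.Icc (fun _ : Fin n => (-1 : ℝ)) fun _ => 1) := by
    ext y
    constructor
    · exact fun h => ⟨WithLp.ofLp y, ⟨fun i => (abs_le.1 (h i)).1, fun i => (abs_le.1 (h i)).2⟩, rfl⟩
    · rintro ⟨z, ⟨h1, h2⟩, rfl⟩ i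
      exact abs_le.2 ⟨h1 i, h2 i⟩
  rw [h]
  exact isCompact_Icc.image (PiLp.continuous_toLp 2 _)

theorem crossPolytope_subset_cube (n : ℕ) : crossPolytope n ⊆ cube n := fun y hy i =>
  (Finset.single_le_sum (f := fun i => |y i|) (fun _ _ => abs_nonneg _) (Finset.mem_univ i)).trans hy

theorem isCompact_crossPolytope (n : ℕ) : IsCompact (crossPolytope n) :=
  (isCompact_cube n).of_isClosed_subset (isClosed_le (by fun_prop) continuous_const)
    (crossPolytope_subset_cube n)

theorem convex_cube (n : ℕ) : Convex ℝ (cube n) := by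
  have h : cube n = ⋂ p, {y | (inner ℝ (axisVec p) y : ℝ) ≤ 1} := by
    ext y; simp [mem_cube_iff_axisVec]
  rw [h]
  exact convex_iInter fun p => convex_halfSpace_le (innerₛₗ ℝ (axisVec p)).isLinear 1

theorem convex_crossPolytope (n : ℕ) : Convex ℝ (crossPolytope n) := by
  have h : crossPolytope n = ⋂ p, {y | (inner ℝ (signVec p) y : ℝ) ≤ 1} := by
    ext y; simp [mem_crossPolytope_iff_signVec]
  rw [h]
  exact convex_iInter fun p => convex_halfSpace_le (innerₛₗ ℝ (signVec p)).isLinear 1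

theorem volume_cube (n : ℕ) : volume (cube n) = ENNReal.ofReal (2 ^ n) := by
  have h : cube n = WithLp.ofLp ⁻¹' (Set.Icc (fun _ : Fin n => (-1 : ℝ)) fun _ => 1) := by
    ext y
    simp only [cube, Set.mem_ofPred_eq, Set.mem_preimage, Set.mem_Icc, Pi.le_def, abs_le,
      forall_and]
  rw [h, (PiLp.volume_preserving_ofLp (Fin n)).measure_preimage measurableSet_Icc.nullMeasurableSet,
    Real.volume_Icc_pi]
  norm_num

theorem volume_crossPolytope (hn : n ≠ 0) :
    volume (crossPolytope n) = ENNReal.ofReal (2 ^ n / n !) := by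
  have : Nonempty (Fin n) := ⟨⟨0, Nat.pos_of_ne_zero hn⟩⟩
  have h : crossPolytope n = WithLp.ofLp ⁻¹'
      {x : Fin n → ℝ | (∑ i, |x i| ^ (1 : ℝ)) ^ (1 / (1 : ℝ)) ≤ 1} := by
    ext y; simp [crossPolytope]
  rw [h, (PiLp.volume_preserving_ofLp (Fin n)).measure_preimage
    (measurableSet_le (by fun_prop) measurable_const).nullMeasurableSet,
    volume_sum_rpow_le (Fin n) le_rfl 1]
  simp only [ENNReal.ofReal_one, one_pow, one_mul, Fintype.card_fin, div_one]
  rw [Real.Gamma_nat_eq_factorial]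
  norm_num [Real.Gamma_two]

theorem volume_facetCone_crossPolytope (hn : n ≠ 0) (σ : Fin n → Bool) :
    ENNReal.ofReal (2 ^ n) * volume (facetCone (crossPolytope n) (signVec σ))
      = volume (crossPolytope n) := by
  have hn' : (n : ℝ) ≠ 0 := by exact_mod_cast hn
  have h := card_mul_volume_facetCone (v := signVec) signVec_injective (fun τ h0 => ?_)
    (K := crossPolytope n) mem_crossPolytope_iff_signVec (isCompact_crossPolytope n)
    (fun τ => ?_) σ (fun τ => ?_)
  · rw [← h]
    simp
  · have := abs_signVec τ ⟨0, Nat.pos_of_ne_zero hn⟩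
    rw [h0] at this
    simp at this
  · refine ⟨(1 / (n : ℝ)) • signVec τ, ?_, ?_⟩
    · simp [crossPolytope, abs_mul, abs_signVec, hn]
    · rw [inner_smul_right, inner_eq_sum]
      have : ∀ i, signVec τ i * signVec τ i = 1 := fun i => by
        rw [← abs_mul_abs_self, abs_signVec, one_mul]
      simp [this, hn]
  · let g : EuclideanSpace ℝ (Fin n) ≃ₗᵢ[ℝ] EuclideanSpace ℝ (Fin n) :=
      LinearIsometryEquiv.piLpCongrRight 2 fun i =>
        if σ i = τ i then LinearIsometryEquiv.refl ℝ ℝ else LinearIsometryEquiv.neg ℝ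
    have hg : ∀ x i, g x i = if σ i = τ i then x i else -x i := by
      intro x i
      simp only [g, LinearIsometryEquiv.piLpCongrRight_apply]
      split_ifs <;> simp
    have hgσ : g (signVec σ) = signVec τ := by
      ext i
      rw [hg, signVec_apply, signVec_apply]
      cases σ i <;> cases τ i <;> simp
    rw [← hgσ, volume_facetCone_map g]
    intro x
    have : ∀ i, |g x i| = |x i| := fun i => by rw [hg]; split_ifs <;> simp
    simp [crossPolytope, this]

theorem volume_facetCone_cube (p : Fin n × Bool) :
    ENNReal.ofReal (2 * n) * volume (facetCone (cube n) (axisVec p)) = volume (cube n) := by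
  have h := card_mul_volume_facetCone (v := axisVec) axisVec_injective (fun q h0 => ?_)
    (K := cube n) mem_cube_iff_axisVec (isCompact_cube n)
    (fun q => ?_) p (fun q => ?_)
  · rw [← h]
    simp [mul_comm]
  · have h1 := inner_axisVec q (EuclideanSpace.single q.1 (1 : ℝ))
    rw [h0] at h1
    simp at h1
    split_ifs at h1 <;> norm_num at h1
  · refine ⟨axisVec q, fun i => ?_, ?_⟩
    · simp only [axisVec, PiLp.single_apply]
      split_ifs <;> simp
    · rw [inner_axisVec]
      simp only [axisVec, PiLp.single_apply]
      split_ifs <;> simp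
  · let g₁ : EuclideanSpace ℝ (Fin n) ≃ₗᵢ[ℝ] EuclideanSpace ℝ (Fin n) :=
      LinearIsometryEquiv.piLpCongrLeft 2 ℝ ℝ (Equiv.swap p.1 q.1)
    let g₂ : EuclideanSpace ℝ (Fin n) ≃ₗᵢ[ℝ] EuclideanSpace ℝ (Fin n) :=
      if p.2 = q.2 then LinearIsometryEquiv.refl ℝ _ else LinearIsometryEquiv.neg ℝ
    have hg₁ : g₁ (axisVec p) = axisVec (q.1, p.2) := by
      simp only [g₁, axisVec, EuclideanSpace.single]
      rw [LinearIsometryEquiv.piLpCongrLeft_single, Equiv.swap_apply_left]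
    have hg₂ : g₂ (axisVec (q.1, p.2)) = axisVec q := by
      simp only [g₂]
      split_ifs with h
      · rw [h]; rfl
      · obtain ⟨i, a⟩ := p
        obtain ⟨j, b⟩ := q
        ext k
        simp only [axisVec, LinearIsometryEquiv.coe_neg, PiLp.neg_apply, PiLp.single_apply]
        cases a <;> cases b <;> simp at h ⊢ <;> split_ifs <;> simp
    rw [← hg₂, volume_facetCone_map g₂, ← hg₁, volume_facetCone_map g₁]
    · intro x
      simp only [cube, Set.mem_ofPred_eq, g₁, LinearIsometryEquiv.piLpCongrLeft_apply]
      refine ⟨fun h i => ?_, fun h i => h _⟩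
      simpa using h (Equiv.swap p.1 q.1 i)
    · intro x
      simp only [g₂]
      split_ifs <;> simp [cube]

theorem signVec_ne_zero (hn : n ≠ 0) (σ : Fin n → Bool) : signVec σ ≠ 0 := by
  intro h0
  have := abs_signVec σ ⟨0, Nat.pos_of_ne_zero hn⟩
  rw [h0] at this
  simp at this

theorem axisVec_ne_zero (p : Fin n × Bool) : axisVec p ≠ 0 := by
  intro h0
  have h1 := inner_axisVec p (EuclideanSpace.single p.1 (1 : ℝ))
  rw [h0] at h1
  simp at h1
  split_ifs at h1 <;> norm_num at h1

theorem inner_le_sum_abs_mul (x y : EuclideanSpace ℝ (Fin n)) :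
    (inner ℝ x y : ℝ) ≤ ∑ i, |x i| * |y i| := by
  rw [inner_eq_sum]
  exact Finset.sum_le_sum fun i _ => (le_abs_self _).trans (abs_mul _ _).le

theorem inner_le_sum_abs_of_mem_cube (x : EuclideanSpace ℝ (Fin n))
    {y : EuclideanSpace ℝ (Fin n)} (hy : y ∈ cube n) : (inner ℝ x y : ℝ) ≤ ∑ i, |x i| :=
  (inner_le_sum_abs_mul x y).trans
    (Finset.sum_le_sum fun i _ => mul_le_of_le_one_right (abs_nonneg _) (hy i))

theorem polarBody_cube (n : ℕ) : polarBody (cube n) = crossPolytope n := by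
  ext y
  constructor
  · intro h
    exact (mem_crossPolytope_iff_signVec y).2 fun σ => h _ fun i => (abs_signVec σ i).le
  · intro hy x hx
    rw [real_inner_comm]
    exact (inner_le_sum_abs_of_mem_cube y hx).trans hy

theorem axisVec_mem_crossPolytope (p : Fin n × Bool) : axisVec p ∈ crossPolytope n := by
  refine (mem_crossPolytope_iff_signVec _).2 fun σ => ?_
  rw [real_inner_comm, inner_axisVec, signVec_apply]
  split_ifs <;> norm_num

theorem polarBody_crossPolytope (n : ℕ) : polarBody (crossPolytope n) = cube n := by
  ext y
  constructor
  · intro h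
    exact (mem_cube_iff_axisVec y).2 fun p => h _ (axisVec_mem_crossPolytope p)
  · intro hy x hx
    exact (inner_le_sum_abs_of_mem_cube x hy).trans hx

/-! ### Floating body of the cube, illumination body of the cross-polytope. -/

theorem inner_le_one_of_mem_floatingBody {K : Set (EuclideanSpace ℝ (Fin n))}
    {v : EuclideanSpace ℝ (Fin n)} (hv : v ≠ 0) (hK : ∀ y ∈ K, (inner ℝ v y : ℝ) ≤ 1) {δ : ℝ}
    {y : EuclideanSpace ℝ (Fin n)} (hy : y ∈ floatingBody K δ) : (inner ℝ v y : ℝ) ≤ 1 := by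
  by_contra! hlt
  -- The hyperplane halfway between `1` and `⟪v, y⟫` misses `K`, so it is an admissible cut for
  -- every `δ`.
  have h : K ∩ {z | (1 + inner ℝ v y) / 2 ≤ (inner ℝ v z : ℝ)} = ∅ := by
    rw [Set.eq_empty_iff_forall_notMem]
    rintro z ⟨hz, hz'⟩
    have h1 := hK z hz
    have h2 : (1 + inner ℝ v y) / 2 ≤ (inner ℝ v z : ℝ) := hz'
    linarith
  have := hy v _ hv (by rw [h, measure_empty]; exact zero_le)
  linarith

theorem floatingBody_cube_subset (δ : ℝ) : floatingBody (cube n) δ ⊆ cube n := fun _ hy =>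
  (mem_cube_iff_axisVec _).2 fun p => inner_le_one_of_mem_floatingBody (axisVec_ne_zero p)
    (fun _ hz => (mem_cube_iff_axisVec _).1 hz p) hy

theorem floatingBody_crossPolytope_subset (hn : n ≠ 0) (δ : ℝ) :
    floatingBody (crossPolytope n) δ ⊆ crossPolytope n := fun _ hy =>
  (mem_crossPolytope_iff_signVec _).2 fun p => inner_le_one_of_mem_floatingBody
    (signVec_ne_zero hn p) (fun _ hz => (mem_crossPolytope_iff_signVec _).1 hz p) hy

theorem volume_cube_ne_zero (n : ℕ) : volume (cube n) ≠ 0 := by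
  rw [volume_cube]; positivity

theorem volume_cube_ne_top (n : ℕ) : volume (cube n) ≠ ⊤ := by
  rw [volume_cube]; simp

theorem volume_crossPolytope_ne_zero (hn : n ≠ 0) : volume (crossPolytope n) ≠ 0 := by
  rw [volume_crossPolytope hn]; positivity

theorem volume_crossPolytope_ne_top (hn : n ≠ 0) : volume (crossPolytope n) ≠ ⊤ := by
  rw [volume_crossPolytope hn]; simp

theorem sum_abs_le_of_mem_illuminationBody (hn : n ≠ 0) {ρ : ℝ} (hρ : 0 ≤ ρ)
    {x : EuclideanSpace ℝ (Fin n)}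
    (hx : x ∈ illuminationBody (crossPolytope n) (ρ / 2 ^ n)) : ∑ i, |x i| ≤ 1 + ρ := by
  obtain ⟨σ, hσ, -⟩ := exists_inner_signVec_eq x
  rw [← hσ]
  exact inner_le_of_mem_illuminationBody (isCompact_crossPolytope n).measurableSet
    (volume_crossPolytope_ne_zero hn) (volume_crossPolytope_ne_top hn)
    (fun y hy => (mem_crossPolytope_iff_signVec y).1 hy σ) (by positivity) hρ
    (volume_facetCone_crossPolytope hn σ) hx

/-- A point at height `ρ` over a facet of the cross-polytope, far from the boundary of the facet,
lies in the illumination body. -/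
theorem mem_illuminationBody_crossPolytope (hn : n ≠ 0) {ρ : ℝ} (hρ : 0 < ρ)
    {x : EuclideanSpace ℝ (Fin n)} (hx : ∑ i, |x i| = 1 + ρ) (hxi : ∀ i, ρ / 2 ≤ |x i|) :
    x ∈ illuminationBody (crossPolytope n) (ρ / 2 ^ n) := by
  obtain ⟨σ, hσ, hσi⟩ := exists_inner_signVec_eq x
  refine mem_illuminationBody_of_inner_le (convex_crossPolytope n) ⟨0, by simp [crossPolytope]⟩
    (fun y hy => (mem_crossPolytope_iff_signVec y).1 hy σ) (by positivity) hρ.le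
    (volume_facetCone_crossPolytope hn σ) (by rw [hσ, hx]; linarith) (by rw [hσ, hx]) ?_
  intro y hy hy1
  refine (mem_crossPolytope_iff_signVec y).2 fun τ => ?_
  by_cases hτ : τ = σ
  · rw [hτ]; exact hy1
  obtain ⟨j, hj⟩ := Function.ne_iff.1 hτ
  have hxτ : (inner ℝ (signVec τ) x : ℝ) ≤ 1 := by
    have h1 : signVec τ j * x j = -|x j| := by
      rw [← hσi j, signVec_apply, signVec_apply]
      cases h2 : τ j <;> cases h3 : σ j <;> simp [h2, h3] at hj ⊢
    have h2 : (inner ℝ (signVec τ) x : ℝ) ≤ ∑ i, |x i| - 2 * |x j| := by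
      rw [inner_eq_sum, ← Finset.add_sum_erase _ _ (Finset.mem_univ j), h1,
        ← Finset.add_sum_erase _ (fun i => |x i|) (Finset.mem_univ j)]
      have : ∑ i ∈ Finset.univ.erase j, signVec τ i * x i
          ≤ ∑ i ∈ Finset.univ.erase j, |x i| := by
        refine Finset.sum_le_sum fun i _ => (le_abs_self _).trans ?_
        rw [abs_mul, abs_signVec, one_mul]
      linarith
    linarith [hxi j]
  have hsub : convexHull ℝ (insert x (crossPolytope n)) ⊆
      {z | (inner ℝ (signVec τ) z : ℝ) ≤ 1} := by
    refine convexHull_min (Set.insert_subset hxτ fun z hz => ?_)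
      (convex_halfSpace_le (innerₛₗ ℝ (signVec τ)).isLinear 1)
    exact (mem_crossPolytope_iff_signVec z).1 hz τ
  exact hsub hy

/-- The box with half-sides `w i` centred at `p` fits into the cube and has volume ratio `∏ w i`. -/
theorem mem_floatingBody_cube {δ : ℝ} (hδ : 0 ≤ δ) {w : Fin n → ℝ} (hw : ∀ i, 0 ≤ w i)
    (hwδ : 2 * δ < ∏ i, w i) {p : EuclideanSpace ℝ (Fin n)} (hp : ∀ i, |p i| ≤ 1 - w i) :
    p ∈ floatingBody (cube n) δ := by
  refine mem_floatingBody_of_image (fun x hx i => by simpa using hx i) (volume_cube_ne_zero n)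
    (volume_cube_ne_top n) hδ (diagMap w) (fun z hz i => ?_) ?_
  · rw [PiLp.add_apply, diagMap_apply]
    refine (abs_add_le _ _).trans ?_
    rw [abs_mul, abs_of_nonneg (hw i)]
    nlinarith [hp i, hz i, hw i, mul_le_mul_of_nonneg_left (hz i) (hw i)]
  · rw [det_diagMap, abs_of_nonneg (Finset.prod_nonneg fun i _ => hw i)]
    exact hwδ

theorem prod_abs_le {u : Fin n → ℝ} {U : ℝ} (hU : ∑ i, |u i| = U) (hn : n ≠ 0) :
    ∏ i, |u i| ≤ (U / n) ^ n := by
  have hn0 : (0 : ℝ) < n := by positivity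
  have h := Real.geom_mean_le_arith_mean_weighted Finset.univ (fun _ => 1 / (n : ℝ))
    (fun i => |u i|) (fun _ _ => by positivity) (by simp [hn]) (fun _ _ => abs_nonneg _)
  rw [← Finset.mul_sum, hU, one_div_mul_eq_div] at h
  refine le_trans (le_of_eq ?_) (pow_le_pow_left₀ (Finset.prod_nonneg fun _ _ => by positivity) h n)
  rw [← Finset.prod_pow]
  refine Finset.prod_congr rfl fun i _ => ?_
  rw [← Real.rpow_natCast, ← Real.rpow_mul (abs_nonneg _), one_div_mul_cancel hn0.ne',
    Real.rpow_one]

/-- The volume of the simplex `{z ≥ 0, ∑ z_i < 1}` in terms of a facet cone. -/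
theorem volume_standardCone (hn : n ≠ 0) :
    volume (facetCone (crossPolytope n) (signVec fun _ => true)) = ENNReal.ofReal (1 / n !) := by
  have h := volume_facetCone_crossPolytope hn fun _ => true
  have h2 : ENNReal.ofReal (2 ^ n / n !) = ENNReal.ofReal (2 ^ n) * ENNReal.ofReal (1 / n !) := by
    rw [← ENNReal.ofReal_mul (by positivity), mul_one_div]
  rw [volume_crossPolytope hn, h2] at h
  exact (ENNReal.mul_right_inj (by positivity) ENNReal.ofReal_ne_top).1 h

theorem standardCone_bounds {z : EuclideanSpace ℝ (Fin n)}
    (hz : z ∈ facetCone (crossPolytope n) (signVec fun _ => true)) :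
    (∀ i, 0 ≤ z i) ∧ ∑ i, z i ≤ 1 := by
  obtain ⟨c, h0, h1, f, hf, hvf, rfl⟩ := hz
  rw [inner_eq_sum] at hvf
  simp only [signVec_apply, if_true, one_mul] at hvf
  have hf' : ∑ i, |f i| ≤ 1 := hf
  have hfi : ∀ i, 0 ≤ f i := by
    intro i
    by_contra! hlt
    have : ∑ i, f i < ∑ i, |f i| := Finset.sum_lt_sum (fun j _ => le_abs_self _)
      ⟨i, Finset.mem_univ _, by rw [abs_of_neg hlt]; linarith⟩
    linarith
  refine ⟨fun i => mul_nonneg h0 (hfi i), ?_⟩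
  simp only [PiLp.smul_apply, smul_eq_mul]
  rw [← Finset.mul_sum, hvf]
  linarith

theorem volume_standardSimplex_le (hn : n ≠ 0) :
    volume {z : EuclideanSpace ℝ (Fin n) | (∀ i, 0 ≤ z i) ∧ ∑ i, z i ≤ 1}
      ≤ ENNReal.ofReal (1 / n !) := by
  rw [← volume_standardCone hn]
  have hsub : {z : EuclideanSpace ℝ (Fin n) | (∀ i, 0 ≤ z i) ∧ ∑ i, z i ≤ 1} ⊆
      facetCone (crossPolytope n) (signVec fun _ => true) ∪
        {z | inner ℝ (signVec fun _ => true) z = (1 : ℝ)} := by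
    rintro z ⟨hz, hz1⟩
    have hin : ∀ y : EuclideanSpace ℝ (Fin n),
        (inner ℝ (signVec fun _ => true) y : ℝ) = ∑ i, y i := fun y => by
      simp [inner_eq_sum, signVec_apply]
    rcases hz1.lt_or_eq with h | h
    · left
      have h0 : 0 ≤ ∑ i, z i := Finset.sum_nonneg fun i _ => hz i
      rcases h0.lt_or_eq with h0 | h0
      · refine ⟨∑ i, z i, h0.le, h, (∑ i, z i)⁻¹ • z, ?_, ?_, (smul_inv_smul₀ h0.ne' z).symm⟩
        · change ∑ i, |((∑ i, z i)⁻¹ • z) i| ≤ 1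
          simp only [PiLp.smul_apply, smul_eq_mul, abs_mul, abs_inv, abs_of_pos h0,
            abs_of_nonneg (hz _)]
          rw [← Finset.mul_sum, inv_mul_cancel₀ h0.ne']
        · rw [inner_smul_right, hin, inv_mul_cancel₀ h0.ne']
      · have hz0 : z = 0 := by
          ext i
          exact (Finset.sum_eq_zero_iff_of_nonneg fun i _ => hz i).1 h0.symm i (Finset.mem_univ i)
        exact ⟨0, le_rfl, one_pos, axisVec (⟨0, Nat.pos_of_ne_zero hn⟩, true),
          axisVec_mem_crossPolytope _, by rw [hin]; simp [axisVec], by simp [hz0]⟩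
    · exact Or.inr ((hin z).trans h)
  refine (measure_mono hsub).trans ((measure_union_le _ _).trans ?_)
  rw [volume_inner_eq_const (signVec_ne_zero hn _), add_zero]

/-- Sets of fixed length along an edge and width `s η` across it have volume of order `η^{n-1}`,
which beats `δ = (η / c)^n`. This puts points near edges into the floating body. -/
theorem eventually_mul_pow_lt (hn : n ≠ 0) {A b c s : ℝ} (hA : 0 < A) (hb : 0 < b) (hc : 0 < c)
    (hs : 0 < s) : ∀ᶠ η : ℝ in 𝓝[>] 0, A * (η / c) ^ n < b * (s * η) ^ (n - 1) := by
  obtain ⟨k, rfl⟩ := Nat.exists_eq_succ_of_ne_zero hn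
  filter_upwards [self_mem_nhdsWithin, nhdsWithin_le_nhds
    (gt_mem_nhds (show (0 : ℝ) < b * s ^ k * c ^ (k + 1) / A by positivity))] with η hη hη'
  replace hη : 0 < η := hη
  rw [lt_div_iff₀ hA] at hη'
  simp only [Nat.succ_eq_add_one, Nat.add_sub_cancel]
  rw [div_pow, mul_pow, ← mul_div_assoc, div_lt_iff₀ (by positivity), pow_succ η]
  have : 0 < η ^ k := by positivity
  nlinarith [mul_lt_mul_of_pos_right hη' this]

theorem prod_ite_eq_mul_pow (j : Fin n) (a b : ℝ) :
    ∏ i, (if i = j then a else b) = a * b ^ (n - 1) := by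
  rw [← Finset.mul_prod_erase _ _ (Finset.mem_univ j), if_pos rfl]
  congr 1
  rw [Finset.prod_congr rfl fun i hi => if_neg (Finset.ne_of_mem_erase hi), Finset.prod_const,
    Finset.card_erase_of_mem (Finset.mem_univ j), Finset.card_univ, Fintype.card_fin]

theorem sum_ite_eq_add_mul (j : Fin n) (a b : ℝ) :
    ∑ i, (if i = j then a else b) = a + ((n : ℝ) - 1) * b := by
  rw [← Finset.add_sum_erase _ _ (Finset.mem_univ j), if_pos rfl]
  congr 1
  rw [Finset.sum_congr rfl fun i hi => if_neg (Finset.ne_of_mem_erase hi), Finset.sum_const,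
    Finset.card_erase_of_mem (Finset.mem_univ j), Finset.card_univ, Fintype.card_fin,
    nsmul_eq_mul, Nat.cast_sub (Fin.pos j), Nat.cast_one]

/-- A half-space cutting off little volume from the cube and transversal to all edges stays at
depth at most about `η`, where `(n η)^n / n!` is the volume allowed. -/
theorem le_of_volume_cube_inter_le (hn : n ≠ 0) {δ η s : ℝ} (hη : 0 < η) (hs : 0 < s) (hs1 : s ≤ 3)
    (hδ : δ * 2 ^ n = (n * η) ^ n / n !) {u : EuclideanSpace ℝ (Fin n)} {t U : ℝ} (hU0 : 0 < U)
    (hU : ∑ i, |u i| = U) (hu : ∀ i, 2 * η * U ≤ |u i|)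
    (hcut : volume (cube n ∩ {y | t ≤ inner ℝ u y}) ≤ ENNReal.ofReal δ * volume (cube n)) :
    (1 - (1 + s) * η) * U ≤ t := by
  by_contra! hlt
  obtain ⟨σ, hσ, hσi⟩ := exists_inner_signVec_eq u
  have hn0 : (0 : ℝ) < n := by positivity
  have hui : ∀ i, 0 < |u i| := fun i => lt_of_lt_of_le (by positivity) (hu i)
  set τ : ℝ := (1 + s) * η * U with hτ
  have hτ0 : 0 < τ := by positivity
  set w : Fin n → ℝ := fun i => -(signVec σ i * (τ / |u i|)) with hw
  set C := facetCone (crossPolytope n) (signVec fun _ => true) with hC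
  have hsub : signVec σ +ᵥ diagMap w '' C ⊆ cube n ∩ {y | t ≤ inner ℝ u y} := by
    rintro _ ⟨_, ⟨z, hz, rfl⟩, rfl⟩
    obtain ⟨hz0, hz1⟩ := standardCone_bounds hz
    have hy : ∀ i, (signVec σ + diagMap w z) i = signVec σ i * (1 - τ / |u i| * z i) := by
      intro i
      rw [PiLp.add_apply, diagMap_apply, hw]
      ring
    constructor
    · intro i
      change |(signVec σ + diagMap w z) i| ≤ 1
      rw [hy, abs_mul, abs_signVec, one_mul]
      -- The legs of the corner simplex do not exceed the edge length `2`: `τ ≤ 4 η U ≤ 2 |u i|`,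
      -- using `s ≤ 3`.
      have h1 : τ / |u i| ≤ 2 := by
        rw [div_le_iff₀ (hui i)]
        have := mul_pos hη hU0
        nlinarith [hu i]
      have h2 : 0 ≤ τ / |u i| := by positivity
      have h3 : z i ≤ 1 :=
        (Finset.single_le_sum (fun j _ => hz0 j) (Finset.mem_univ i)).trans hz1
      rw [abs_le]
      constructor <;> nlinarith [hz0 i, mul_nonneg h2 (hz0 i)]
    · change t ≤ inner ℝ u (signVec σ + diagMap w z)
      rw [inner_eq_sum]
      have h1 : ∀ i, u i * (signVec σ + diagMap w z) i = |u i| - τ * z i := by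
        intro i
        rw [hy, ← mul_assoc, mul_comm (u i), hσi, mul_sub, mul_one, ← mul_assoc,
          mul_div_cancel₀ _ (hui i).ne']
      rw [Finset.sum_congr rfl fun i _ => h1 i, Finset.sum_sub_distrib, ← Finset.mul_sum, hU]
      nlinarith
  have h := (measure_mono hsub).trans hcut
  have hdet : |LinearMap.det (diagMap w)| = τ ^ n / ∏ i, |u i| := by
    rw [det_diagMap, Finset.abs_prod]
    simp only [hw, abs_neg, abs_mul, abs_signVec, one_mul, abs_div, abs_abs, abs_of_pos hτ0]
    rw [Finset.prod_div_distrib, Finset.prod_const, Finset.card_univ, Fintype.card_fin]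
  have hprod : 0 < ∏ i, |u i| := Finset.prod_pos fun i _ => hui i
  rw [measure_vadd, Measure.addHaar_image_linearMap, hdet, hC, volume_standardCone hn, volume_cube,
    ← ENNReal.ofReal_mul (by positivity), ← ENNReal.ofReal_mul' (by positivity), hδ,
    ENNReal.ofReal_le_ofReal_iff (by positivity), mul_one_div] at h
  rw [div_le_div_iff_of_pos_right (by positivity), div_le_iff₀ hprod] at h
  -- By AM-GM, among cuts of given volume the diagonal one is deepest relative to `U`.
  have h1 := prod_abs_le hU hn
  have h2 : (n * η) ^ n * ∏ i, |u i| ≤ (η * U) ^ n := by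
    calc (n * η) ^ n * ∏ i, |u i| ≤ (n * η) ^ n * (U / n) ^ n := by gcongr
      _ = (η * U) ^ n := by rw [← mul_pow]; congr 1; field_simp
  have h3 : (η * U) ^ n < τ ^ n := by
    refine pow_lt_pow_left₀ ?_ (by positivity) hn
    rw [hτ, mul_assoc]
    have := mul_pos hη hU0
    nlinarith
  linarith

/-- The diagonal cut lies in a corner simplex with legs `n η`, whose volume `(nη)^n / n!` is exactly
what `δ` allows. -/
theorem inner_le_of_mem_floatingBody_cube (hn : n ≠ 0) {δ η : ℝ} (hη : 0 < η)
    (hδ : δ * 2 ^ n = (n * η) ^ n / n !) {y : EuclideanSpace ℝ (Fin n)}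
    (hy : y ∈ floatingBody (cube n) δ) :
    (inner ℝ ((1 / (n : ℝ)) • signVec fun _ => true) y : ℝ) ≤ 1 - η := by
  have hn0 : (0 : ℝ) < n := by positivity
  refine hy _ _ (smul_ne_zero (by positivity) (signVec_ne_zero hn _)) ?_
  have hin : ∀ y : EuclideanSpace ℝ (Fin n),
      (inner ℝ (signVec fun _ => true) y : ℝ) = ∑ i, y i := fun y => by
    simp [inner_eq_sum, signVec_apply]
  have hsub : cube n ∩ {y | 1 - η ≤ inner ℝ ((1 / (n : ℝ)) • signVec fun _ => true) y} ⊆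
      (signVec (fun _ : Fin n => true)) +ᵥ (-(n * η)) •
        {z : EuclideanSpace ℝ (Fin n) | (∀ i, 0 ≤ z i) ∧ ∑ i, z i ≤ 1} := by
    rintro y ⟨hy, hy'⟩
    have hy1 : 1 - η ≤ inner ℝ ((1 / (n : ℝ)) • signVec fun _ => true) y := hy'
    rw [real_inner_smul_left, hin, one_div_mul_eq_div, le_div_iff₀ hn0] at hy1
    refine ⟨_, ⟨(1 / (n * η)) • ((signVec fun _ => true) - y), ⟨fun i => ?_, ?_⟩, rfl⟩, ?_⟩
    · have h1 : y i ≤ 1 := (abs_le.1 (hy i)).2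
      simp only [PiLp.smul_apply, PiLp.sub_apply, signVec_apply, if_true, smul_eq_mul]
      have : 0 ≤ 1 - y i := by linarith
      positivity
    · simp only [PiLp.smul_apply, PiLp.sub_apply, signVec_apply, if_true, smul_eq_mul]
      rw [← Finset.mul_sum, Finset.sum_sub_distrib, Finset.sum_const, Finset.card_univ,
        Fintype.card_fin, nsmul_eq_mul, mul_one, one_div_mul_eq_div, div_le_one (by positivity)]
      linarith
    · have h1 : (n : ℝ) * η ≠ 0 := by positivity
      simp only [vadd_eq_add, smul_smul, neg_mul, mul_one_div_cancel h1, neg_smul, one_smul]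
      abel
  refine (measure_mono hsub).trans ?_
  rw [measure_vadd, Measure.addHaar_smul, finrank_euclideanSpace, Fintype.card_fin, abs_pow,
    abs_neg, abs_of_pos (by positivity), volume_cube, ← ENNReal.ofReal_mul' (by positivity), hδ,
    ← mul_one_div, ENNReal.ofReal_mul (by positivity)]
  gcongr
  exact volume_standardSimplex_le hn

theorem tendsto_floatIllumDist_cube (hn : 2 ≤ n) :
    Tendsto (fun δ : ℝ => (floatIllumDist (cube n) δ - 1) / δ ^ ((1 : ℝ) / (n : ℝ)))
      (𝓝[>] (0 : ℝ)) (𝓝 (((n ! : ℕ) : ℝ) ^ ((1 : ℝ) / (n : ℝ)) / (n : ℝ))) := by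
  have hn' : n ≠ 0 := by omega
  have hn0 : (0 : ℝ) < n := by positivity
  have hn2 : (2 : ℝ) ≤ n := by exact_mod_cast hn
  let j₀ : Fin n := ⟨0, by omega⟩
  set r : ℝ := ((n ! : ℕ) : ℝ) ^ ((1 : ℝ) / (n : ℝ)) with hr
  have hr0 : 0 < r := by positivity
  have hrn : r ^ n = (n ! : ℕ) := by
    rw [hr, ← Real.rpow_natCast, ← Real.rpow_mul (by positivity), one_div_mul_cancel hn0.ne',
      Real.rpow_one]
  have hδ : ∀ η : ℝ, (η / (2 * (r / n))) ^ n * 2 ^ n = (n * η) ^ n / n ! := by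
    intro η
    rw [← hrn, ← mul_pow, ← div_pow]
    congr 1
    field_simp
  have hpolar : ∀ δ' : ℝ, polarIllumination (cube n) δ'
      = polarBody (illuminationBody (crossPolytope n) δ') := fun δ' => by
    rw [polarIllumination, polarBody_cube]
  have hc : 0 < 2 * (r / n) := by positivity
  have h := tendsto_floatIllumDist hn' (S := cube n) (m := 2 ^ n) (c := 2 * (r / n))
    (u₀ := (1 / (n : ℝ)) • signVec fun _ => true) (w := signVec fun _ => true)
    (by positivity) hc ?_ floatingBody_cube_subset ?_ ?_
    (fun i => (abs_signVec _ i).le) ?_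
    (fun η hη _ y hy => inner_le_of_mem_floatingBody_cube hn' hη (hδ η) hy) ?_ ?_
  · rwa [mul_div_cancel_left₀ _ (two_ne_zero)] at h
  · intro x hx a h0 h1 i
    rw [PiLp.smul_apply, smul_eq_mul, abs_mul, abs_of_nonneg h0]
    nlinarith [hx i, abs_nonneg (x i)]
  · intro ρ hρ y hy
    rw [hpolar] at hy
    rw [← polarBody_crossPolytope]
    exact fun x hx => hy x
      (subset_illuminationBody (convex_crossPolytope n) (by positivity) hx)
  · intro ρ hρ y hy
    rw [hpolar]
    intro x hx
    rw [inner_smul_right, one_div_mul_eq_div, div_le_one (by positivity)]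
    exact (inner_le_sum_abs_of_mem_cube x hy).trans
      (sum_abs_le_of_mem_illuminationBody hn' hρ.le hx)
  · rw [real_inner_smul_left, inner_eq_sum]
    simp [signVec_apply, hn']
  · intro s hs hs4
    filter_upwards [self_mem_nhdsWithin, eventually_mul_pow_lt hn' two_pos hs hc hs,
      nhdsWithin_le_nhds (gt_mem_nhds (show (0 : ℝ) < 2 / n by positivity)),
      nhdsWithin_le_nhds (gt_mem_nhds (show (0 : ℝ) < 1 by norm_num))] with η hη hη' hηn hη1
    replace hη : 0 < η := hη
    -- A point next to an edge in direction `j₀`, at distance `s` from the vertex along it.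
    refine ⟨WithLp.toLp 2 fun i => 1 - if i = j₀ then s else s * η, ?_, ?_⟩
    · refine mem_floatingBody_cube (by positivity) (w := fun i => if i = j₀ then s else s * η)
        (fun i => by split_ifs <;> positivity) ?_ (fun i => le_of_eq (abs_of_nonneg ?_))
      · rwa [prod_ite_eq_mul_pow]
      · dsimp only
        split_ifs <;> nlinarith
    · intro ρ hρ hρη a ha hP
      rw [hpolar] at hP
      have hn1 : 0 < (n : ℝ) - 1 := by linarith
      have hρn : ρ * n ≤ 2 := by
        rw [lt_div_iff₀ hn0] at hηn
        nlinarith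
      set q : ℝ := (1 + ρ / 2) / (n - 1) with hq
      have hqn : (n - 1) * q = 1 + ρ / 2 := mul_div_cancel₀ _ hn1.ne'
      have hq0 : 0 < q := by positivity
      -- The weight at `j₀`, where the point is `s` short of the vertex, is `ρ / 2`, the least that
      -- `mem_illuminationBody_crossPolytope` permits.
      have hx := hP (WithLp.toLp 2 fun i => if i = j₀ then ρ / 2 else q)
        (mem_illuminationBody_crossPolytope hn' hρ ?_ ?_)
      · rw [inner_smul_right, one_div_mul_eq_div, div_le_one ha, inner_eq_sum] at hx
        have h1 : ∀ i : Fin n, (if i = j₀ then ρ / 2 else q) * (1 - if i = j₀ then s else s * η)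
            = if i = j₀ then ρ / 2 * (1 - s) else q * (1 - s * η) := by
          intro i; split_ifs <;> rfl
        simp only [h1] at hx
        rw [sum_ite_eq_add_mul, ← mul_assoc, hqn] at hx
        nlinarith [mul_pos hs hη, mul_pos hs hρ, mul_pos (mul_pos hs hη) hρ]
      · have h1 : ∀ i : Fin n, |if i = j₀ then ρ / 2 else q| = if i = j₀ then ρ / 2 else q := by
          intro i
          exact abs_of_nonneg (by split_ifs <;> positivity)
        simp only [h1]
        rw [sum_ite_eq_add_mul, hqn]
        ring
      · intro i
        refine le_trans ?_ (le_abs_self _)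
        dsimp only
        split_ifs
        · exact le_rfl
        · rw [hq, le_div_iff₀ hn1]
          nlinarith
  · intro s hs hs4
    filter_upwards [self_mem_nhdsWithin, eventually_mul_pow_lt hn' two_pos hs hc hs,
      nhdsWithin_le_nhds (gt_mem_nhds (show (0 : ℝ) < 1 by norm_num))] with η hη hη' hη1 u t hu hcut
    replace hη : 0 < η := hη
    have hU0 : 0 < ∑ i, |u i| := by
      refine lt_of_le_of_ne (Finset.sum_nonneg fun i _ => abs_nonneg _) fun h0 => hu ?_
      ext i
      exact abs_eq_zero.1 ((Finset.sum_eq_zero_iff_of_nonneg fun i _ => abs_nonneg _).1 h0.symm i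
        (Finset.mem_univ i))
    refine ⟨∑ i, |u i|, hU0.le, fun y hy => inner_le_sum_abs_of_mem_cube u hy, ?_⟩
    set U := ∑ i, |u i| with hU
    -- A small `|u j|` means a cut almost parallel to an edge. The edge point then loses at most `s
    -- η U + s |u j| ≤ 3 s η U`.
    by_cases hj : ∃ j, |u j| ≤ 2 * η * U
    · left
      obtain ⟨j, hj⟩ := hj
      obtain ⟨σ, hσ, hσi⟩ := exists_inner_signVec_eq u
      have hp : (WithLp.toLp 2 fun i => signVec σ i * (1 - if i = j then s else s * η)) ∈
          floatingBody (cube n) ((η / (2 * (r / n))) ^ n) := by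
        refine mem_floatingBody_cube (by positivity) (w := fun i => if i = j then s else s * η)
          (fun i => by split_ifs <;> positivity) ?_ (fun i => le_of_eq ?_)
        · rwa [prod_ite_eq_mul_pow]
        · dsimp only
          rw [abs_mul, abs_signVec, one_mul, abs_of_nonneg]
          split_ifs <;> nlinarith
      refine le_trans ?_ (hp u t hu hcut)
      rw [inner_eq_sum]
      have h1 : ∀ i, |u i| * (1 - s * η) - (if i = j then s * |u j| else 0)
          ≤ u i * (signVec σ i * (1 - if i = j then s else s * η)) := by
        intro i
        rw [← mul_assoc, mul_comm (u i), hσi]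
        split_ifs with hij
        · subst hij
          nlinarith [abs_nonneg (u i), mul_pos hs hη]
        · linarith
      refine le_trans ?_ (Finset.sum_le_sum fun i _ => h1 i)
      rw [Finset.sum_sub_distrib, ← Finset.sum_mul, ← hU, Finset.sum_ite_eq' Finset.univ j,
        if_pos (Finset.mem_univ j)]
      nlinarith
    · right
      push Not at hj
      refine ⟨le_of_volume_cube_inter_le hn' hη hs (by linarith) (hδ η) hU0 hU.symm
        (fun i => (hj i).le) hcut, fun y hy => ?_⟩
      rw [hpolar] at hy
      have hx := hy (((1 + η / 2) / U) • u)
        (mem_illuminationBody_crossPolytope hn' (by positivity) ?_ ?_)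
      · rwa [real_inner_smul_left, div_mul_eq_mul_div, div_le_one hU0, mul_comm,
          ← le_div_iff₀ (by positivity)] at hx
      · simp only [PiLp.smul_apply, smul_eq_mul, abs_mul]
        rw [← Finset.mul_sum, ← hU, abs_of_pos (by positivity), div_mul_cancel₀ _ hU0.ne']
      · intro i
        rw [PiLp.smul_apply, smul_eq_mul, abs_mul, abs_of_pos (by positivity), div_mul_eq_mul_div,
          le_div_iff₀ hU0]
        have := mul_pos hη hU0
        nlinarith [hj i, mul_le_mul_of_nonneg_left (hj i).le hη.le]

/-! ### Floating body of the cross-polytope, illumination body of the cube. -/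

theorem abs_le_of_mem_illuminationBody (hn : n ≠ 0) {ρ : ℝ} (hρ : 0 ≤ ρ)
    {x : EuclideanSpace ℝ (Fin n)}
    (hx : x ∈ illuminationBody (cube n) (ρ / (2 * n))) (i : Fin n) : |x i| ≤ 1 + ρ := by
  have h : ∀ p, (inner ℝ (axisVec p) x : ℝ) ≤ 1 + ρ := fun p =>
    inner_le_of_mem_illuminationBody (isCompact_cube n).measurableSet
      (volume_cube_ne_zero n) (volume_cube_ne_top n)
      (fun y hy => (mem_cube_iff_axisVec y).1 hy p) (by positivity) hρ
      (volume_facetCone_cube p) hx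
  have h1 := h (i, true)
  have h2 := h (i, false)
  simp only [inner_axisVec, if_true, Bool.false_eq_true, if_false] at h1 h2
  exact abs_le.2 ⟨by linarith, h1⟩

/-- A point at height `ρ` straight above a facet of the cube lies in the illumination body. -/
theorem mem_illuminationBody_cube (hn : n ≠ 0) {ρ : ℝ} (hρ : 0 < ρ)
    {x : EuclideanSpace ℝ (Fin n)} {i : Fin n} (hx : |x i| = 1 + ρ)
    (hxi : ∀ j, j ≠ i → |x j| ≤ 1) :
    x ∈ illuminationBody (cube n) (ρ / (2 * n)) := by
  obtain ⟨b, hb⟩ : ∃ b, (inner ℝ (axisVec (i, b)) x : ℝ) = |x i| := by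
    rcases abs_choice (x i) with h | h
    · exact ⟨true, by simp [inner_axisVec, h]⟩
    · exact ⟨false, by simp [inner_axisVec, h]⟩
  refine mem_illuminationBody_of_inner_le (convex_cube n) ⟨0, by simp [cube]⟩
    (fun y hy => (mem_cube_iff_axisVec y).1 hy (i, b)) (by positivity) hρ.le
    (volume_facetCone_cube (i, b)) (by rw [hb, hx]; linarith) (by rw [hb, hx]) ?_
  intro y hy hy1
  refine (mem_cube_iff_axisVec y).2 fun q => ?_
  by_cases hq : q = (i, b)
  · rw [hq]; exact hy1
  have hxq : (inner ℝ (axisVec q) x : ℝ) ≤ 1 := by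
    by_cases hqi : q.1 = i
    · obtain ⟨j, a⟩ := q
      obtain rfl : j = i := hqi
      have hab : a ≠ b := fun h => hq (by rw [h])
      have : (inner ℝ (axisVec (j, a)) x : ℝ) = - inner ℝ (axisVec (j, b)) x := by
        simp only [inner_axisVec]
        cases a <;> cases b <;> simp at hab ⊢
      rw [this, hb]
      linarith [abs_nonneg (x j)]
    · refine le_trans ?_ (hxi q.1 hqi)
      rw [inner_axisVec]
      split_ifs
      · exact le_abs_self _
      · exact neg_le_abs _
  have hsub : convexHull ℝ (insert x (cube n)) ⊆ {z | (inner ℝ (axisVec q) z : ℝ) ≤ 1} := by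
    refine convexHull_min (Set.insert_subset hxq fun z hz => ?_)
      (convex_halfSpace_le (innerₛₗ ℝ (axisVec q)).isLinear 1)
    exact (mem_cube_iff_axisVec z).1 hz q
  exact hsub hy

theorem neg_mem_crossPolytope {x : EuclideanSpace ℝ (Fin n)} (hx : x ∈ crossPolytope n) :
    -x ∈ crossPolytope n := by
  simpa [crossPolytope] using hx

theorem sum_abs_add_le (x y : EuclideanSpace ℝ (Fin n)) :
    ∑ i, |(x + y) i| ≤ ∑ i, |x i| + ∑ i, |y i| := by
  rw [← Finset.sum_add_distrib]
  exact Finset.sum_le_sum fun i _ => abs_add_le _ _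

theorem sum_abs_smul (r : ℝ) (x : EuclideanSpace ℝ (Fin n)) :
    ∑ i, |(r • x) i| = |r| * ∑ i, |x i| := by
  simp only [PiLp.smul_apply, smul_eq_mul, abs_mul]
  rw [Finset.mul_sum]

theorem sum_abs_axisVec (p : Fin n × Bool) : ∑ i, |axisVec p i| = 1 := by
  simp only [axisVec, PiLp.single_apply, apply_ite abs, abs_zero]
  rw [Finset.sum_ite_eq' Finset.univ p.1]
  split_ifs <;> simp_all

theorem smul_axisVec_mem_floatingBody (hn : n ≠ 0) {δ r : ℝ} (hδ : 0 ≤ δ) (hr : 0 ≤ r)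
    (hr1 : r ≤ 1) (hrδ : 2 * δ < r ^ n) (p : Fin n × Bool) :
    (1 - r) • axisVec p ∈ floatingBody (crossPolytope n) δ := by
  refine mem_floatingBody_of_image (fun x => neg_mem_crossPolytope)
    (volume_crossPolytope_ne_zero hn) (volume_crossPolytope_ne_top hn) hδ
    (r • LinearMap.id) (fun z hz => ?_) ?_
  · refine (sum_abs_add_le _ _).trans ?_
    have hz' : ∑ i, |z i| ≤ 1 := hz
    rw [LinearMap.smul_apply, LinearMap.id_apply, sum_abs_smul, sum_abs_smul, sum_abs_axisVec,
      abs_of_nonneg hr, abs_of_nonneg (by linarith)]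
    nlinarith
  · rw [LinearMap.det_smul, LinearMap.det_id, finrank_euclideanSpace, Fintype.card_fin, mul_one,
      abs_of_nonneg (by positivity)]
    exact hrδ

/-- Points close to an edge of the cross-polytope that lie in its floating body. -/
theorem edge_mem_floatingBody (hn : n ≠ 0) {δ r s : ℝ} (hδ : 0 ≤ δ) (hr : 0 < r)
    (hr1 : r ≤ 1 / 2) (hs : 0 < s) (hs1 : s ≤ 1 / 2) (hrδ : 2 * δ < s / 2 * r ^ (n - 1))
    {p q : Fin n × Bool} (hpq : p.1 ≠ q.1) :
    (1 - r) • ((1 - s) • axisVec p + s • axisVec q) ∈ floatingBody (crossPolytope n) δ := by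
  refine mem_floatingBody_of_image (fun x => neg_mem_crossPolytope)
    (volume_crossPolytope_ne_zero hn) (volume_crossPolytope_ne_top hn) hδ
    -- The transvection stretches the small copy `r K` along the edge direction, which raises its
    -- volume ratio from `r^n` to `r^n (1 + s / (2 r))`, of order `s r^{n-1}`.
    (r • LinearMap.transvection (innerₛₗ ℝ (axisVec p)) ((s / (2 * r)) • (axisVec p - axisVec q)))
    (fun z hz => ?_) ?_
  · have hz' : ∑ i, |z i| ≤ 1 := hz
    set a : ℝ := inner ℝ (axisVec p) z with ha
    have ha1 : |a| ≤ 1 := by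
      have h1 : |a| = |z p.1| := by
        rw [ha, inner_axisVec]; split_ifs <;> simp
      rw [h1]
      exact crossPolytope_subset_cube n hz p.1
    obtain ⟨h1, h2⟩ := abs_le.1 ha1
    have e : (1 - r) • ((1 - s) • axisVec p + s • axisVec q) +
        (r • LinearMap.transvection (innerₛₗ ℝ (axisVec p))
          ((s / (2 * r)) • (axisVec p - axisVec q))) z =
        (((1 - r) * (1 - s) + s / 2 * a) • axisVec p + ((1 - r) * s - s / 2 * a) • axisVec q)
          + r • z := by
      have : r * (a * (s / (2 * r))) = s / 2 * a := by field_simp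
      simp only [LinearMap.smul_apply, LinearMap.transvection.apply, innerₛₗ_apply_apply, ← ha,
        smul_add, smul_smul, this]
      module
    rw [e]
    refine (sum_abs_add_le _ _).trans ?_
    -- Both coefficients are nonnegative and sum to `1 - r` whatever `a` is, leaving exactly `r` for
    -- `r • z`.
    have h3 := sum_abs_add_le (((1 - r) * (1 - s) + s / 2 * a) • axisVec p)
      (((1 - r) * s - s / 2 * a) • axisVec q)
    rw [sum_abs_smul, sum_abs_smul, sum_abs_axisVec, sum_abs_axisVec,
      abs_of_nonneg (show 0 ≤ (1 - r) * (1 - s) + s / 2 * a by nlinarith),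
      abs_of_nonneg (show 0 ≤ (1 - r) * s - s / 2 * a by nlinarith)] at h3
    rw [sum_abs_smul, abs_of_pos hr]
    nlinarith
  · have h1 : (inner ℝ (axisVec p) (axisVec p - axisVec q) : ℝ) = 1 := by
      rw [inner_axisVec]
      simp only [axisVec, PiLp.sub_apply, PiLp.single_apply, hpq, if_false, if_true]
      split_ifs <;> norm_num
    rw [LinearMap.det_smul, LinearMap.transvection.det, innerₛₗ_apply_apply, inner_smul_right, h1,
      finrank_euclideanSpace, Fintype.card_fin, abs_of_nonneg (by positivity)]
    refine hrδ.trans_le ?_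
    have h2 : r ^ n = r ^ (n - 1) * r := by
      rw [← pow_succ, Nat.sub_add_cancel (Nat.pos_of_ne_zero hn)]
    have h3 : r ^ n * (1 + s / (2 * r) * 1) = r ^ n + s / 2 * r ^ (n - 1) := by
      rw [h2]; field_simp
    rw [h3]
    have : 0 ≤ r ^ n := by positivity
    linarith

/-- The cap at a vertex lies in half of an `η`-scaled copy centred at height `1 - η`, of volume
ratio `η^n / 2 = δ`. -/
theorem inner_le_of_mem_floatingBody_crossPolytope {δ η : ℝ} (hη : 0 < η) (hη1 : η ≤ 1)
    (hδ : 2 * δ = η ^ n) (i : Fin n) {y : EuclideanSpace ℝ (Fin n)}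
    (hy : y ∈ floatingBody (crossPolytope n) δ) :
    (inner ℝ (axisVec (i, true)) y : ℝ) ≤ 1 - η := by
  refine hy _ _ (axisVec_ne_zero _) ?_
  have hsub : crossPolytope n ∩ {y | 1 - η ≤ inner ℝ (axisVec (i, true)) y} ⊆
      ((1 - η) • axisVec (i, true)) +ᵥ (η • crossPolytope n ∩
        {z | 0 ≤ (inner ℝ (axisVec (i, true)) z : ℝ)}) := by
    rintro y ⟨hy, hy'⟩
    have hy1 : 1 - η ≤ inner ℝ (axisVec (i, true)) y := hy'
    have hy2 : ∑ j, |y j| ≤ 1 := hy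
    rw [inner_axisVec] at hy1
    simp only [if_true] at hy1
    refine ⟨y - (1 - η) • axisVec (i, true), ⟨⟨η⁻¹ • (y - (1 - η) • axisVec (i, true)), ?_, ?_⟩, ?_⟩,
      ?_⟩
    · have h1 : ∀ j, |(y - (1 - η) • axisVec (i, true)) j|
          = |y j| - if j = i then 1 - η else 0 := by
        intro j
        simp only [PiLp.sub_apply, PiLp.smul_apply, axisVec, PiLp.single_apply, if_true,
          smul_eq_mul]
        split_ifs with hji
        · subst hji
          rw [abs_of_nonneg (by linarith), abs_of_nonneg (by linarith)]
          ring
        · simp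
      change ∑ j, |(η⁻¹ • (y - (1 - η) • axisVec (i, true))) j| ≤ 1
      rw [sum_abs_smul, Finset.sum_congr rfl fun j _ => h1 j, Finset.sum_sub_distrib,
        Finset.sum_ite_eq' Finset.univ i, if_pos (Finset.mem_univ i), abs_of_pos (by positivity),
        inv_mul_le_iff₀ hη]
      linarith
    · exact smul_inv_smul₀ hη.ne' _
    · change 0 ≤ (inner ℝ (axisVec (i, true)) (y - (1 - η) • axisVec (i, true)) : ℝ)
      rw [inner_axisVec]
      simp only [PiLp.sub_apply, PiLp.smul_apply, axisVec, PiLp.single_apply, if_true,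
          smul_eq_mul]
      linarith
    · simp
  refine (measure_mono hsub).trans ?_
  have hsymm : ∀ x ∈ η • crossPolytope n, -x ∈ η • crossPolytope n := by
    rintro _ ⟨z, hz, rfl⟩
    exact ⟨-z, neg_mem_crossPolytope hz, by simp⟩
  have h2 := two_mul_volume_inter_halfspace hsymm (axisVec_ne_zero (i, true))
  rw [Measure.addHaar_smul, finrank_euclideanSpace, Fintype.card_fin,
    abs_of_nonneg (by positivity), ← hδ, ENNReal.ofReal_mul (by norm_num), mul_assoc,
    ENNReal.ofReal_ofNat] at h2
  rw [measure_vadd]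
  exact ((ENNReal.mul_right_inj (by norm_num) (by norm_num)).1 h2).le

theorem tendsto_floatIllumDist_crossPolytope (hn : 2 ≤ n) :
    Tendsto (fun δ : ℝ => (floatIllumDist (crossPolytope n) δ - 1) / δ ^ ((1 : ℝ) / (n : ℝ)))
      (𝓝[>] (0 : ℝ)) (𝓝 ((2 : ℝ) ^ ((1 : ℝ) / (n : ℝ)) / 2)) := by
  have hn' : n ≠ 0 := by omega
  have hn0 : (0 : ℝ) < n := by positivity
  let i₀ : Fin n := ⟨0, by omega⟩
  let j₀ : Fin n := ⟨1, by omega⟩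
  have hij : i₀ ≠ j₀ := by simp [i₀, j₀]
  set c : ℝ := (2 : ℝ) ^ ((1 : ℝ) / (n : ℝ)) with hc
  have hc0 : 0 < c := by positivity
  have hcn : c ^ n = 2 := by
    rw [hc, ← Real.rpow_natCast, ← Real.rpow_mul (by positivity), one_div_mul_cancel hn0.ne',
      Real.rpow_one]
  have hδ : ∀ η : ℝ, 2 * (η / c) ^ n = η ^ n := by
    intro η
    rw [div_pow, hcn]
    ring
  have hpolar : ∀ δ' : ℝ, polarIllumination (crossPolytope n) δ'
      = polarBody (illuminationBody (cube n) δ') := fun δ' => by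
    rw [polarIllumination, polarBody_crossPolytope]
  refine tendsto_floatIllumDist hn' (S := crossPolytope n) (m := 2 * n) (c := c)
    (u₀ := axisVec (i₀, true)) (w := axisVec (i₀, true))
    (by positivity) hc0 ?_ (floatingBody_crossPolytope_subset hn') ?_ ?_
    (axisVec_mem_crossPolytope _) ?_
    ?_ ?_ ?_
  · intro x hx a h0 h1
    change ∑ i, |(a • x) i| ≤ 1
    have hx' : ∑ i, |x i| ≤ 1 := hx
    rw [sum_abs_smul, abs_of_nonneg h0]
    nlinarith
  · intro ρ hρ y hy
    rw [hpolar] at hy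
    rw [← polarBody_cube]
    exact fun x hx => hy x (subset_illuminationBody (convex_cube n) (by positivity) hx)
  · intro ρ hρ y hy
    rw [hpolar]
    intro x hx
    rw [inner_smul_right, one_div_mul_eq_div, div_le_one (by positivity)]
    refine (inner_le_sum_abs_mul x y).trans ?_
    have hy' : ∑ i, |y i| ≤ 1 := hy
    calc ∑ i, |x i| * |y i| ≤ ∑ i, (1 + ρ) * |y i| := Finset.sum_le_sum fun i _ =>
          mul_le_mul_of_nonneg_right (abs_le_of_mem_illuminationBody hn' hρ.le hx i) (abs_nonneg _)
      _ ≤ 1 + ρ := by rw [← Finset.mul_sum]; nlinarith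
  · rw [inner_axisVec]
    simp [axisVec]
  · exact fun η hη hη1 y hy =>
      inner_le_of_mem_floatingBody_crossPolytope hη hη1 (hδ η) i₀ hy
  · intro s hs hs4
    filter_upwards [self_mem_nhdsWithin, eventually_mul_pow_lt hn' two_pos (half_pos hs) hc0 hs,
      nhdsWithin_le_nhds (gt_mem_nhds (show (0 : ℝ) < 1 by norm_num))] with η hη hη' hη1
    replace hη : 0 < η := hη
    refine ⟨_, edge_mem_floatingBody hn' (by positivity) (mul_pos hs hη) (by nlinarith) hs
      (by linarith) hη' (p := (i₀, true)) (q := (j₀, true)) hij, ?_⟩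
    intro ρ hρ hρη a ha hP
    rw [hpolar] at hP
    -- The entry `1` at `j₀`, the largest allowed by the cube facets, reduces the loss at the edge
    -- point to `s ρ ≤ s η`.
    have hx := hP ((1 + ρ) • axisVec (i₀, true) + axisVec (j₀, true))
      (mem_illuminationBody_cube hn' hρ (i := i₀) ?_ ?_)
    · rw [inner_smul_right, one_div_mul_eq_div, div_le_one ha, inner_smul_right, real_inner_comm,
        inner_add_left, real_inner_smul_left, real_inner_smul_left, inner_axisVec,
        inner_axisVec] at hx
      simp [axisVec, hij, hij.symm] at hx
      nlinarith [mul_pos hs hη, mul_pos hs hρ, mul_pos (mul_pos hs hη) hρ,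
        mul_le_mul_of_nonneg_left hρη hs.le]
    · simp only [axisVec, PiLp.add_apply, PiLp.smul_apply, PiLp.single_apply, hij, if_true,
        if_false, smul_eq_mul, mul_one, add_zero]
      exact abs_of_pos (by linarith)
    · intro j hj
      simp only [axisVec, PiLp.add_apply, PiLp.smul_apply, PiLp.single_apply, hj, if_true,
        if_false, smul_eq_mul, mul_zero, zero_add]
      split_ifs <;> simp
  · intro s hs hs4
    filter_upwards [self_mem_nhdsWithin, eventually_mul_pow_lt hn' two_pos (half_pos hs) hc0 hs,
      nhdsWithin_le_nhds (gt_mem_nhds (show (0 : ℝ) < 1 / 2 by norm_num))]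
      with η hη hη' hη1 u t hu hcut
    replace hη : 0 < η := hη
    obtain ⟨i, -, hi⟩ := Finset.exists_max_image Finset.univ (fun i => |u i|)
      ⟨i₀, Finset.mem_univ _⟩
    replace hi : ∀ j, |u j| ≤ |u i| := fun j => hi j (Finset.mem_univ j)
    have hU0 : 0 < |u i| := by
      refine lt_of_le_of_ne (abs_nonneg _) fun h0 => hu ?_
      ext j
      exact abs_eq_zero.1 (le_antisymm (by rw [h0]; exact hi j) (abs_nonneg _))
    have hb : ∀ j, ∃ b, (inner ℝ u (axisVec (j, b)) : ℝ) = |u j| := by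
      intro j
      rcases abs_choice (u j) with h | h
      · exact ⟨true, by rw [real_inner_comm]; simp [inner_axisVec, h]⟩
      · exact ⟨false, by rw [real_inner_comm]; simp [inner_axisVec, h]⟩
    obtain ⟨b, hb'⟩ := hb i
    refine ⟨|u i|, hU0.le, fun y hy => ?_, ?_⟩
    · refine (inner_le_sum_abs_mul u y).trans ?_
      have hy' : ∑ i, |y i| ≤ 1 := hy
      calc ∑ j, |u j| * |y j| ≤ ∑ j, |u i| * |y j| := Finset.sum_le_sum fun j _ =>
            mul_le_mul_of_nonneg_right (hi j) (abs_nonneg _)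
        _ ≤ |u i| := by rw [← Finset.mul_sum]; nlinarith
    -- The threshold `1 - η / 2` ensures `(1 + η / 2)(1 - η / 2) ≤ 1`, so in the other case the
    -- rescaled normal lies straight above a facet of the cube.
    by_cases hj : ∃ j, j ≠ i ∧ (1 - η / 2) * |u i| ≤ |u j|
    · left
      obtain ⟨j, hji, hj⟩ := hj
      obtain ⟨b', hb''⟩ := hb j
      have hp := edge_mem_floatingBody hn' (δ := (η / c) ^ n) (by positivity) (mul_pos hs hη)
        (by nlinarith) hs (by linarith) hη' (p := (i, b)) (q := (j, b')) hji.symm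
      refine le_trans ?_ (hp u t hu hcut)
      rw [inner_smul_right, inner_add_right, inner_smul_right, inner_smul_right, hb', hb'']
      have h1 : (1 - s * η / 2) * |u i| ≤ (1 - s) * |u i| + s * |u j| := by nlinarith
      refine le_trans ?_ (mul_le_mul_of_nonneg_left h1 (by nlinarith))
      rw [← mul_assoc]
      gcongr
      nlinarith [mul_pos hs hη, sq_nonneg (s * η)]
    · right
      push Not at hj
      constructor
      · have hp := smul_axisVec_mem_floatingBody hn' (δ := (η / c) ^ n) (r := (1 + s) * η)
          (by positivity) (by positivity) (by nlinarith)
          (by rw [hδ]; exact pow_lt_pow_left₀ (by nlinarith) hη.le hn') (i, b)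
        have := hp u t hu hcut
        rwa [inner_smul_right, hb'] at this
      · intro y hy
        rw [hpolar] at hy
        have hx := hy (((1 + η / 2) / |u i|) • u)
          (mem_illuminationBody_cube hn' (by positivity) (i := i) ?_ ?_)
        · rwa [real_inner_smul_left, div_mul_eq_mul_div, div_le_one hU0, mul_comm,
            ← le_div_iff₀ (by positivity)] at hx
        · rw [PiLp.smul_apply, smul_eq_mul, abs_mul, abs_of_pos (by positivity),
            div_mul_cancel₀ _ hU0.ne']
        · intro j hji
          rw [PiLp.smul_apply, smul_eq_mul, abs_mul, abs_of_pos (by positivity),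
            div_mul_eq_mul_div, div_le_one hU0]
          have := hj j hji
          nlinarith [mul_pos hη hU0, mul_pos hη (mul_pos hη hU0)]

end FloatIllum

theorem mainTheorem2 (n : ℕ) (hn : 2 ≤ n) :
    Tendsto (fun δ : ℝ => (FloatIllum.floatIllumDist (FloatIllum.cube n) δ - 1) /
        δ ^ ((1 : ℝ) / (n : ℝ)))
      (𝓝[>] (0 : ℝ)) (𝓝 (((n ! : ℕ) : ℝ) ^ ((1 : ℝ) / (n : ℝ)) / (n : ℝ))) ∧
    Tendsto (fun δ : ℝ => (FloatIllum.floatIllumDist (FloatIllum.crossPolytope n) δ - 1) /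
        δ ^ ((1 : ℝ) / (n : ℝ)))
      (𝓝[>] (0 : ℝ)) (𝓝 ((2 : ℝ) ^ ((1 : ℝ) / (n : ℝ)) / 2)) :=
  ⟨FloatIllum.tendsto_floatIllumDist_cube hn, FloatIllum.tendsto_floatIllumDist_crossPolytope hn⟩
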